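/- For each $n\ge 1$ let $D_n=\operatorname{diag}(\lambda_{n,1},\dots,\lambda_{n,n})$ be a real diagonal matrix, let $X_n=\frac1{\sqrt n}[x^n_{i,j}]_{1\le i,j\le n}$ be a Hermitian random matrix, and let $\varepsilon=\varepsilon_n>0$ satisfy $\varepsilon_n\sqrt n\to 0$. Suppose that: (a) for each $n$ the entries $x^n_{i,j}$, $i\le j$, are independent and centred, with variances $\sigma_n^2(i,j)=\mathbb E|x^n_{i,j}|^2$, and $\mathbb E|x^n_{i,j}|^6$ is bounded uniformly in $n,i,j$; (b) there are bounded real functions $f$ on $[0,1]$ and $\sigma$ on $[0,1]^2$ such that $$\eta_n:=\sup_{x}|\lambda_{n,\lfloor nx\rfloor}-f(x)|+\sup_{x,y}|\sigma_n^2(\lfloor nx\rfloor,\lfloor ny\rfloor)-\sigma^2(x,y)|\longrightarrow 0,$$ where the suprema run over the $x,y\in[0,1]$ with $\lfloor nx\rfloor,\lfloor ny\rfloor\ge 1$; (c) the push-forward by $f$ of the uniform measure on $[0,1]$ has a density $\rho$ with respect to Lebesgue measure on $\mathbb R$, and compact support; (d) there is a symmetric function $\tau$ on $\mathbb R^2$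 with $\sigma^2(x,y)=\tau(f(x),f(y))$ for all $x\neq y$ in $[0,1]$. For $s\in\mathbb R$ and $\varphi:\mathbb R\to\mathbb C$ of class $\mathcal C^2$ put $$\Xi_s(\varphi):=\int_{\mathbb R}\tau(s,t)\rho(t)\,\frac{\varphi(t)-\varphi(s)-(t-s)\varphi'(s)}{(t-s)^2}\,\mathrm dt .$$ For a Hermitian matrix $A$ with orthonormal eigenvectors $u_j$ and eigenvalues $\mu_j$ let $\varphi(A)=\sum_j\varphi(\mu_j)u_ju_j^*$, so that $\varphi(A)_{ii}$ is the integral of $\varphi$ against the spectral measure $\sum_j|\langle u_j,e_i\rangle|^2\delta_{\mu_j}$. Then for every $R$ there is a constant $C>0$ (depending on $R$ and on the above data, but not on $n$, $x$ or $\varphi$) such that, for every $\mathcal C^7$ function $\varphi:\mathbb R\to\mathbb C$ with support in $[-R,R]$ and every $x\in[0,1]$, the integral $\Xi_{f(x)}(\varphi)$ converges absolutely and, for every $n\geq 1$ with $i:=\lfloor nx\rfloor\ge 1$, $$\varphi(D_n+\varepsilon X_n)_{ii}=\varphi\Big(\lambda_{n,i}+\frac{\varepsilon}{\sqrt n}x^n_{ii}\Big)+\varepsilon^2\,\Xi_{f(x)}(\varphi)+U_n,$$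 where $U_n$ is a square-integrable random variable with $$\big(\mathbb E|U_n|^2\big)^{1/2}\le C\,\varepsilon^2\,\|\varphi^{(7)}\|_\infty\Big(\eta_n+\frac1{\sqrt n}+\varepsilon\sqrt n\Big).$$ -/

import Mathlib

open MeasureTheory ProbabilityTheory Filter Topology Set

noncomputable section

namespace PerturbedDiagonal

/-- The matrix `φ(A)` for a Hermitian matrix `A` and `φ : ℝ → ℂ`, through the spectral theorem:
if `A = U diag(μ₁, …, μₙ) U*` with `U` unitary, then `φ(A) = U diag(φ(μ₁), …, φ(μₙ)) U*`.
(The value for a non-Hermitian `A` is irrelevant.) -/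
def matrixFun {n : ℕ} (φ : ℝ → ℂ) (A : Matrix (Fin n) (Fin n) ℂ) :
    Matrix (Fin n) (Fin n) ℂ :=
  open Classical in
  if hA : A.IsHermitian then
    (hA.eigenvectorUnitary : Matrix (Fin n) (Fin n) ℂ) *
      Matrix.diagonal (fun j => φ (hA.eigenvalues j)) *
      (hA.eigenvectorUnitary : Matrix (Fin n) (Fin n) ℂ).conjTranspose
  else 0

/-- `D_n + ε X_n` with `D_n = diag(lam)` and `X_n = n^{-1/2} ξ`. -/
def perturbed {n : ℕ} (lam : Fin n → ℝ) (ε : ℝ) (ξ : Matrix (Fin n) (Fin n) ℂ) :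
    Matrix (Fin n) (Fin n) ℂ :=
  Matrix.diagonal (fun i => (lam i : ℂ)) + (ε : ℂ) • (((1 / √(n : ℝ) : ℝ) : ℂ) • ξ)

/-- `i` is the index `⌊n x⌋`. Rows and columns are numbered `1, …, n` in the mathematics, and
`i : Fin n` stands for the number `i + 1`. -/
def IsFloorIndex (n : ℕ) (x : ℝ) (i : Fin n) : Prop :=
  (i : ℕ) + 1 = ⌊(n : ℝ) * x⌋₊

/-- The variance `σ_n²(i,j) = E|ξ_{ij}|²` of a (centred) entry. -/
def entryVariance {Ω : Type*} [MeasurableSpace Ω] (P : Measure Ω) {n : ℕ}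
    (ξ : Ω → Matrix (Fin n) (Fin n) ℂ) (i j : Fin n) : ℝ :=
  ∫ ω, ‖ξ ω i j‖ ^ 2 ∂P

/-- The error bound
`η_n = sup_x |λ_{⌊nx⌋} - f(x)| + sup_{x,y} |σ_n²(⌊nx⌋,⌊ny⌋) - σ²(x,y)|`,
the suprema being over the `x, y ∈ [0,1]` for which the indices `⌊nx⌋`, `⌊ny⌋` lie in
`{1, …, n}`. -/
def eta {Ω : Type*} [MeasurableSpace Ω] (P : Measure Ω) {n : ℕ} (lam : Fin n → ℝ)
    (ξ : Ω → Matrix (Fin n) (Fin n) ℂ) (f : ℝ → ℝ) (σ : ℝ → ℝ → ℝ) : ℝ :=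
  sSup {r : ℝ | ∃ x ∈ Icc (0 : ℝ) 1, ∃ i : Fin n, IsFloorIndex n x i ∧ r = |lam i - f x|} +
  sSup {r : ℝ | ∃ x ∈ Icc (0 : ℝ) 1, ∃ y ∈ Icc (0 : ℝ) 1, ∃ i j : Fin n,
    IsFloorIndex n x i ∧ IsFloorIndex n y j ∧ r = |entryVariance P ξ i j - σ x y ^ 2|}

/-- Hypothesis (a) for the matrices `ξ n = √n X_n`: Hermitian random matrices whose entries are
independent up to symmetry, centred, with uniformly bounded sixth absolute moments. -/
structure EntryHypotheses {Ω : ℕ → Type*} [∀ n, MeasurableSpace (Ω n)]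
    (P : ∀ n, Measure (Ω n)) (ξ : ∀ n, Ω n → Matrix (Fin n) (Fin n) ℂ) : Prop where
  measurable : ∀ n i j, Measurable fun ω => ξ n ω i j
  hermitian : ∀ n ω, (ξ n ω).IsHermitian
  indep : ∀ n, iIndepFun
    (fun (p : {p : Fin n × Fin n // p.1 ≤ p.2}) (ω : Ω n) => ξ n ω p.1.1 p.1.2) (P n)
  centred : ∀ n i j, ∫ ω, ξ n ω i j ∂(P n) = 0
  sixth_moment : ∃ M : NNReal, ∀ n i j, ∫⁻ ω, ‖ξ n ω i j‖ₑ ^ 6 ∂(P n) ≤ M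

/-- Hypothesis (b): `f` and `σ` are bounded on `[0,1]` and `[0,1]²`, and `η_n → 0`. -/
structure ProfileHypotheses {Ω : ℕ → Type*} [∀ n, MeasurableSpace (Ω n)]
    (P : ∀ n, Measure (Ω n)) (lam : ∀ n, Fin n → ℝ)
    (ξ : ∀ n, Ω n → Matrix (Fin n) (Fin n) ℂ) (f : ℝ → ℝ) (σ : ℝ → ℝ → ℝ) : Prop where
  f_bounded : ∃ M : ℝ, ∀ x ∈ Icc (0 : ℝ) 1, |f x| ≤ M
  σ_bounded : ∃ M : ℝ, ∀ x ∈ Icc (0 : ℝ) 1, ∀ y ∈ Icc (0 : ℝ) 1, |σ x y| ≤ M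
  eta_tendsto : Tendsto (fun n => eta (P n) (lam n) (ξ n) f σ) atTop (𝓝 0)

/-- Hypothesis (c): the push-forward of the uniform measure on `[0,1]` by `f` has density `ρ` and
compact support. -/
structure DensityHypotheses (f ρ : ℝ → ℝ) : Prop where
  f_aemeasurable : AEMeasurable f (volume.restrict (Icc (0 : ℝ) 1))
  ρ_measurable : Measurable ρ
  ρ_nonneg : ∀ t, 0 ≤ ρ t
  map_eq : (volume.restrict (Icc (0 : ℝ) 1)).map f =
    volume.withDensity fun t => ENNReal.ofReal (ρ t)
  compact_support : IsCompact ((volume.restrict (Icc (0 : ℝ) 1)).map f).support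

/-- Hypothesis (d): `σ²(x,y) = τ(f(x), f(y))` for `x ≠ y`, with `τ` symmetric (and such that the
integrals defining `Ξ_s` make sense as far as measurability is concerned). -/
structure VarianceHypotheses (f : ℝ → ℝ) (σ τ : ℝ → ℝ → ℝ) : Prop where
  τ_measurable : ∀ s, Measurable (τ s)
  τ_symm : ∀ s t, τ s t = τ t s
  σ_sq_eq : ∀ x ∈ Icc (0 : ℝ) 1, ∀ y ∈ Icc (0 : ℝ) 1, x ≠ y → σ x y ^ 2 = τ (f x) (f y)

/-- The integrand of `Ξ_s(φ)`. -/
def xiIntegrand (τ : ℝ → ℝ → ℝ) (ρ : ℝ → ℝ) (s : ℝ) (φ : ℝ → ℂ) (t : ℝ) : ℂ :=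
  ((τ s t * ρ t : ℝ) : ℂ) *
    ((φ t - φ s - ((t - s : ℝ) : ℂ) * deriv φ s) / (((t - s) ^ 2 : ℝ) : ℂ))

/-- `Ξ_s(φ) = ∫ τ(s,t) ρ(t) (φ(t) - φ(s) - (t-s) φ'(s)) / (t-s)² dt`. -/
def Xi (τ : ℝ → ℝ → ℝ) (ρ : ℝ → ℝ) (s : ℝ) (φ : ℝ → ℂ) : ℂ :=
  ∫ t, xiIntegrand τ ρ s φ t

/-- The remainder `φ(D_n + ε X_n)_{ii} - φ(λ_i + ε ξ_{ii}/√n) - ε² Ξ_s(φ)`, a function of the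
matrix `ξ = √n X_n`. (Diagonal entries of a Hermitian matrix are real.) -/
def remainder {n : ℕ} (lam : Fin n → ℝ) (ε : ℝ) (τ : ℝ → ℝ → ℝ) (ρ : ℝ → ℝ) (s : ℝ)
    (φ : ℝ → ℂ) (i : Fin n) (ξ : Matrix (Fin n) (Fin n) ℂ) : ℂ :=
  matrixFun φ (perturbed lam ε ξ) i i - φ (lam i + ε / √(n : ℝ) * (ξ i i).re)
    - (ε : ℂ) ^ 2 * Xi τ ρ s φ

end PerturbedDiagonal

end

/-! Write `A = D + B` with `B = (ε/√n) ξ`, eigenvectors `U`, eigenvalues `μ_m`, and expand `φ(t) =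
φ(s) + (t - s) φ'(s) + (t - s)² g(t)` at `s = λ_i`, where `g = φ[s, s, ·]`. The eigenvector equation
says `(BU)_{jm} = (μ_m - λ_j) U_{jm}`, so powers of `μ_m - λ_i` become entries of `BU`. Hence
`φ(A)_{ii}` equals `φ(λ_i) + B_{ii} φ'(λ_i) + ∑_m g(μ_m) |(BU)_{im}|²` exactly. Replacing `g(μ_m)`
by `g(λ_j)` after expanding one factor `BU` turns the last sum into `∑_j |B_{ij}|² g(λ_j)`, at a
third order cost (`norm_matrixFun_sub_le`). Sixth moments make that cost `ε² · ε√n` in `L²`.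

In the main term `(ε²/n) ∑_j |ξ_{ij}|² g(λ_j)`, independence along row `i` allows `|ξ_{ij}|²` to be
replaced by its mean, with `L²` error of order `ε²/√n` (`integral_norm_sq_sum_le`). What is left is
a Riemann sum for `∫₀¹ τ(f(x), f(y)) φ[f(x), f(x), f(y)] dy`, which is `Ξ_{f(x)}(φ)` after the
change of variables `t = f(y)`; the error is of order `η_n + 1/n` (`norm_variance_sum_sub_Xi_le`).
The quadratic Taylor term of `φ(λ_i + B_{ii})` is of order `ε²/n`.

These estimates use bounds on `φ''` and `φ'''` only; compact support bounds both by `φ⁽⁷⁾`. -/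

noncomputable section

namespace PerturbedDiagonal

/-! ### Taylor quotients and their bounds -/

/-- The divided difference `φ[s, s, t]`, in integral form. -/
def taylorQuotient (φ : ℝ → ℂ) (s t : ℝ) : ℂ :=
  ∫ u in (0 : ℝ)..1, ((1 - u : ℝ) : ℂ) * iteratedDeriv 2 φ (s + u * (t - s))

lemma continuous_taylorIntegrand {φ : ℝ → ℂ} (hφ : ContDiff ℝ 2 φ) (s t : ℝ) :
    Continuous fun u : ℝ => ((1 - u : ℝ) : ℂ) * iteratedDeriv 2 φ (s + u * (t - s)) := by
  have := hφ.continuous_iteratedDeriv 2 le_rfl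
  fun_prop

lemma taylor_eq {φ : ℝ → ℂ} (hφ : ContDiff ℝ 2 φ) (s t : ℝ) :
    φ t = φ s + ((t - s : ℝ) : ℂ) * deriv φ s + ((t - s : ℝ) : ℂ) ^ 2 * taylorQuotient φ s t := by
  have h1 : ∀ u, HasDerivAt φ (deriv φ u) u := fun u =>
    (hφ.differentiable (by norm_num) u).hasDerivAt
  have h2 : ∀ u, HasDerivAt (deriv φ) (iteratedDeriv 2 φ u) u := fun u => by
    have := (hφ.differentiable_iteratedDeriv 1 (by norm_num) u).hasDerivAt
    rw [iteratedDeriv_one] at this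
    rwa [iteratedDeriv_succ, iteratedDeriv_one]
  have h3 : ∀ u : ℝ, HasDerivAt (fun u : ℝ => s + u * (t - s)) (t - s) u := fun u => by
    simpa using ((hasDerivAt_id u).mul_const (t - s)).const_add s
  -- Integration by parts is built into this primitive: the two `φ'` terms of its derivative cancel.
  have h4 : ∀ u : ℝ, HasDerivAt (fun u : ℝ => φ (s + u * (t - s)) +
      ((1 - u : ℝ) : ℂ) * (((t - s : ℝ) : ℂ) * deriv φ (s + u * (t - s))))
      (((t - s : ℝ) : ℂ) ^ 2 * (((1 - u : ℝ) : ℂ) * iteratedDeriv 2 φ (s + u * (t - s)))) u := by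
    intro u
    have h5 : HasDerivAt (fun u : ℝ => ((1 - u : ℝ) : ℂ)) (-1) u := by
      simpa using ((hasDerivAt_id u).const_sub 1).ofReal_comp
    have h6 := ((h1 _).scomp u (h3 u)).add
      (h5.mul (((h2 _).scomp u (h3 u)).const_mul ((t - s : ℝ) : ℂ)))
    refine h6.congr_deriv ?_
    simp only [Function.comp, Complex.real_smul]
    ring
  have h7 := intervalIntegral.integral_eq_sub_of_hasDerivAt (a := 0) (b := 1)
    (fun u _ => h4 u)
    ((continuous_const.mul (continuous_taylorIntegrand hφ s t)).intervalIntegrable _ _)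
  rw [intervalIntegral.integral_const_mul] at h7
  rw [taylorQuotient, h7]
  simp

lemma norm_taylorQuotient_le {φ : ℝ → ℂ} {A : ℝ}
    (hA : ∀ t, ‖iteratedDeriv 2 φ t‖ ≤ A) (s t : ℝ) : ‖taylorQuotient φ s t‖ ≤ A := by
  have := intervalIntegral.norm_integral_le_of_norm_le_const (a := 0) (b := 1) (C := A)
    (f := fun u : ℝ => ((1 - u : ℝ) : ℂ) * iteratedDeriv 2 φ (s + u * (t - s))) (by
      intro u hu
      rw [uIoc_of_le zero_le_one] at hu
      rw [norm_mul, Complex.norm_real, Real.norm_of_nonneg (by linarith [hu.2])]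
      have := hA (s + u * (t - s))
      nlinarith [norm_nonneg (iteratedDeriv 2 φ (s + u * (t - s))), hu.1, hu.2])
  simpa [taylorQuotient] using this

lemma norm_iteratedDeriv_sub_le {φ : ℝ → ℂ} {k : ℕ} (hφ : ContDiff ℝ (k + 1 : ℕ) φ) {A : ℝ}
    (hA : ∀ t, ‖iteratedDeriv (k + 1) φ t‖ ≤ A) (s t : ℝ) :
    ‖iteratedDeriv k φ t - iteratedDeriv k φ s‖ ≤ A * |t - s| := by
  have hd : Differentiable ℝ (iteratedDeriv k φ) :=
    hφ.differentiable_iteratedDeriv k (by exact_mod_cast Nat.lt_succ_self k)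
  exact Convex.norm_image_sub_le_of_norm_deriv_le (s := univ) (fun u _ => hd u)
    (fun u _ => by rw [← iteratedDeriv_succ]; exact hA u) convex_univ (mem_univ _) (mem_univ _)

lemma norm_taylorQuotient_sub_le {φ : ℝ → ℂ} (hφ : ContDiff ℝ 3 φ) {A : ℝ}
    (hA : ∀ t, ‖iteratedDeriv 3 φ t‖ ≤ A) (s t s' t' : ℝ) :
    ‖taylorQuotient φ s t - taylorQuotient φ s' t'‖ ≤ A * (|s - s'| + |t - t'|) := by
  have hφ2 : ContDiff ℝ 2 φ := hφ.of_le (by norm_num)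
  have hA0 : 0 ≤ A := (norm_nonneg _).trans (hA 0)
  rw [taylorQuotient, taylorQuotient, ← intervalIntegral.integral_sub
    ((continuous_taylorIntegrand hφ2 s t).intervalIntegrable _ _)
    ((continuous_taylorIntegrand hφ2 s' t').intervalIntegrable _ _)]
  refine (intervalIntegral.norm_integral_le_of_norm_le_const
    (C := A * (|s - s'| + |t - t'|)) ?_).trans (by simp)
  intro u hu
  rw [uIoc_of_le zero_le_one] at hu
  have h1 : |s + u * (t - s) - (s' + u * (t' - s'))| ≤ |s - s'| + |t - t'| := by
    have : s + u * (t - s) - (s' + u * (t' - s')) = (1 - u) * (s - s') + u * (t - t') := by ring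
    rw [this]
    refine (abs_add_le _ _).trans ?_
    rw [abs_mul, abs_mul, abs_of_nonneg hu.1.le, abs_of_nonneg (by linarith [hu.2] : 0 ≤ 1 - u)]
    nlinarith [abs_nonneg (s - s'), abs_nonneg (t - t'), hu.1, hu.2]
  have h2 := norm_iteratedDeriv_sub_le (k := 2) (by exact_mod_cast hφ) hA
    (s' + u * (t' - s')) (s + u * (t - s))
  rw [← mul_sub, norm_mul, Complex.norm_real, Real.norm_of_nonneg (by linarith [hu.2])]
  calc (1 - u) * _ ≤ 1 * (A * (|s - s'| + |t - t'|)) := by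
        refine mul_le_mul (by linarith [hu.1]) (h2.trans ?_) (norm_nonneg _) zero_le_one
        gcongr
    _ = _ := one_mul _

/-! ### Lower derivatives bounded by the top one on a compact support -/

lemma norm_le_of_norm_deriv_le {ψ : ℝ → ℂ} (hψ : Differentiable ℝ ψ) {R B : ℝ}
    (hs : ∀ t ∉ Icc (-R) R, ψ t = 0) (hB : ∀ t, ‖deriv ψ t‖ ≤ B) (t : ℝ) :
    ‖ψ t‖ ≤ (2 * |R| + 1) * B := by
  have hB0 : 0 ≤ B := (norm_nonneg _).trans (hB 0)
  by_cases ht : t ∈ Icc (-R) R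
  -- The base point lies just outside the support, at distance at most `2|R| + 1` from `t`.
  · have h0 : ψ (-R - 1) = 0 := hs _ (fun h => by linarith [h.1])
    have h1 := Convex.norm_image_sub_le_of_norm_deriv_le (s := univ) (x := -R - 1) (y := t)
      (fun u _ => hψ u) (fun u _ => hB u) convex_univ (mem_univ _) (mem_univ _)
    rw [h0, sub_zero] at h1
    refine h1.trans ?_
    rw [mul_comm]
    gcongr
    rw [Real.norm_of_nonneg (by linarith [ht.1])]
    linarith [ht.2, le_abs_self R]
  · rw [hs t ht, norm_zero]
    positivity

lemma norm_iteratedDeriv_le_iSup {φ : ℝ → ℂ} {m : ℕ} (hφ : ContDiff ℝ m φ) {R : ℝ}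
    (hR : tsupport φ ⊆ Icc (-R) R) (k : ℕ) (hk : k ≤ m) (t : ℝ) :
    ‖iteratedDeriv (m - k) φ t‖ ≤ (2 * |R| + 1) ^ k * ⨆ t : ℝ, ‖iteratedDeriv m φ t‖ := by
  have hsupp : ∀ k, ∀ t ∉ Icc (-R) R, iteratedDeriv k φ t = 0 := by
    intro k t ht
    by_contra h
    rw [iteratedDeriv_eq_iteratedFDeriv] at h
    refine ht (hR (support_iteratedFDeriv_subset (𝕜 := ℝ) k (f := φ) ?_))
    intro h0
    exact h (by rw [h0]; rfl)
  induction k generalizing t with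
  | zero =>
    have hc : HasCompactSupport (iteratedDeriv m φ) :=
      HasCompactSupport.intro isCompact_Icc (hsupp m)
    have hb : BddAbove (range fun t => ‖iteratedDeriv m φ t‖) :=
      (hφ.continuous_iteratedDeriv m le_rfl).norm.bddAbove_range_of_hasCompactSupport hc.norm
    simpa using le_ciSup hb t
  | succ k ih =>
    have h1 := norm_le_of_norm_deriv_le
      (hφ.differentiable_iteratedDeriv (m - (k + 1)) (by exact_mod_cast (by omega)))
      (hsupp (m - (k + 1)))
      (fun t => by
        rw [← iteratedDeriv_succ, show m - (k + 1) + 1 = m - k by omega]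
        exact ih (by omega) t) t
    rw [pow_succ']
    linarith

/-! ### Spectral perturbation expansion -/

section Spectral

variable {n : ℕ}

lemma matrixFun_apply (φ : ℝ → ℂ) {A : Matrix (Fin n) (Fin n) ℂ} (hA : A.IsHermitian)
    (i : Fin n) :
    matrixFun φ A i i = ∑ m, φ (hA.eigenvalues m) *
      ((hA.eigenvectorUnitary : Matrix (Fin n) (Fin n) ℂ) i m *
        star ((hA.eigenvectorUnitary : Matrix (Fin n) (Fin n) ℂ) i m)) := by
  rw [matrixFun, dif_pos hA, Matrix.mul_apply]
  refine Finset.sum_congr rfl fun m _ => ?_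
  rw [Matrix.mul_diagonal, Matrix.conjTranspose_apply]
  ring

lemma mul_eigenvectorUnitary {A : Matrix (Fin n) (Fin n) ℂ} (hA : A.IsHermitian) (j m : Fin n) :
    (A * (hA.eigenvectorUnitary : Matrix (Fin n) (Fin n) ℂ)) j m =
      (hA.eigenvalues m : ℂ) * (hA.eigenvectorUnitary : Matrix (Fin n) (Fin n) ℂ) j m := by
  have h := congrFun (hA.mulVec_eigenvectorBasis m) j
  simpa [Matrix.mul_apply, Matrix.mulVec, dotProduct, Matrix.IsHermitian.eigenvectorUnitary_apply]
    using h

lemma sum_mul_star_eigenvectorUnitary {A : Matrix (Fin n) (Fin n) ℂ} (hA : A.IsHermitian)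
    (M : Matrix (Fin n) (Fin n) ℂ) (i j : Fin n) :
    ∑ m, (M * (hA.eigenvectorUnitary : Matrix (Fin n) (Fin n) ℂ)) i m *
      star ((hA.eigenvectorUnitary : Matrix (Fin n) (Fin n) ℂ) j m) = M i j := by
  have h : (hA.eigenvectorUnitary : Matrix (Fin n) (Fin n) ℂ) *
      (hA.eigenvectorUnitary : Matrix (Fin n) (Fin n) ℂ).conjTranspose = 1 :=
    Matrix.mem_unitaryGroup_iff.1 hA.eigenvectorUnitary.2
  have h2 : M * (hA.eigenvectorUnitary : Matrix (Fin n) (Fin n) ℂ) *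
      (hA.eigenvectorUnitary : Matrix (Fin n) (Fin n) ℂ).conjTranspose = M := by
    rw [Matrix.mul_assoc, h, Matrix.mul_one]
  conv_rhs => rw [← h2]
  rw [Matrix.mul_apply]
  rfl

/-- Parseval: right multiplication by a unitary matrix preserves the norm of each row. -/
lemma sum_norm_sq_mul_eigenvectorUnitary {A : Matrix (Fin n) (Fin n) ℂ} (hA : A.IsHermitian)
    (M : Matrix (Fin n) (Fin n) ℂ) (i : Fin n) :
    ∑ m, ‖(M * (hA.eigenvectorUnitary : Matrix (Fin n) (Fin n) ℂ)) i m‖ ^ 2 =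
      ∑ k, ‖M i k‖ ^ 2 := by
  set U := (hA.eigenvectorUnitary : Matrix (Fin n) (Fin n) ℂ) with hU
  have key : ∀ z : ℂ, ((‖z‖ ^ 2 : ℝ) : ℂ) = z * star z := fun z => by
    rw [Complex.star_def, Complex.mul_conj, Complex.normSq_eq_norm_sq]
  rw [← Complex.ofReal_inj]
  simp only [Complex.ofReal_sum, key]
  calc ∑ m, (M * U) i m * star ((M * U) i m)
      = ∑ m, ∑ k, star (M i k) * ((M * U) i m * star (U k m)) := by
        refine Finset.sum_congr rfl fun m _ => ?_
        conv_lhs => rw [Matrix.mul_apply (M := M) (N := U), star_sum, ← Matrix.mul_apply,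
          Finset.mul_sum]
        refine Finset.sum_congr rfl fun k _ => ?_
        rw [star_mul']
        ring
    _ = ∑ k, star (M i k) * M i k := by
        rw [Finset.sum_comm]
        refine Finset.sum_congr rfl fun k _ => ?_
        rw [← Finset.mul_sum, sum_mul_star_eigenvectorUnitary]
    _ = _ := Finset.sum_congr rfl fun k _ => mul_comm _ _

/-- Second order perturbation expansion of a diagonal entry of `φ(D + B)`, with an explicit
third order remainder. -/
theorem norm_matrixFun_sub_le (lam : Fin n → ℝ) (B : Matrix (Fin n) (Fin n) ℂ)
    (hA : (Matrix.diagonal (fun i => (lam i : ℂ)) + B).IsHermitian) (i : Fin n)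
    (φ g : ℝ → ℂ) (c : ℂ) {K : ℝ}
    (hφ : ∀ t, φ t = φ (lam i) + ((t - lam i : ℝ) : ℂ) * c + ((t - lam i : ℝ) : ℂ) ^ 2 * g t)
    (hg : ∀ s t, ‖g s - g t‖ ≤ K * |s - t|) :
    ‖matrixFun φ (Matrix.diagonal (fun i => (lam i : ℂ)) + B) i i - φ (lam i) - B i i * c
        - ∑ j, ((‖B i j‖ ^ 2 : ℝ) : ℂ) * g (lam j)‖ ≤
      K * ∑ j, ‖B i j‖ * (√(∑ k, ‖B j k‖ ^ 2) * √(∑ k, ‖B i k‖ ^ 2)) := by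
  set U := (hA.eigenvectorUnitary : Matrix (Fin n) (Fin n) ℂ) with hU
  set μ := hA.eigenvalues with hμ
  set V := B * U with hVdef
  have hV : ∀ j m, V j m = ((μ m - lam j : ℝ) : ℂ) * U j m := by
    intro j m
    have h := mul_eigenvectorUnitary hA j m
    rw [Matrix.add_mul, Matrix.add_apply, Matrix.diagonal_mul] at h
    push_cast
    linear_combination h
  have hUU : ∑ m, U i m * star (U i m) = 1 := by
    have h := sum_mul_star_eigenvectorUnitary hA 1 i i
    rwa [Matrix.one_mul, Matrix.one_apply_eq] at h
  have h1 : matrixFun φ (Matrix.diagonal (fun i => (lam i : ℂ)) + B) i i =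
      φ (lam i) + B i i * c + ∑ m, g (μ m) * (V i m * star (V i m)) := by
    rw [matrixFun_apply φ hA i]
    calc _ = ∑ m, (φ (lam i) * (U i m * star (U i m)) + c * (V i m * star (U i m)) +
          g (μ m) * (V i m * star (V i m))) := by
          refine Finset.sum_congr rfl fun m _ => ?_
          rw [hφ (hA.eigenvalues m), hV i m, star_mul', Complex.star_def, Complex.conj_ofReal]
          ring
      _ = _ := by
          rw [Finset.sum_add_distrib, Finset.sum_add_distrib, ← Finset.mul_sum, ← Finset.mul_sum,
            hUU, sum_mul_star_eigenvectorUnitary hA B i i]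
          ring
  -- Only one of the two factors `V i m` is expanded over `j`, so that `g (μ m) - g (lam j)` will
  -- stand next to `U j m`.
  have h2 : ∑ m, g (μ m) * (V i m * star (V i m)) =
      ∑ j, ∑ m, B i j * g (μ m) * (U j m * star (V i m)) := by
    rw [Finset.sum_comm]
    refine Finset.sum_congr rfl fun m _ => ?_
    rw [hVdef, Matrix.mul_apply, Finset.sum_mul, Finset.mul_sum]
    refine Finset.sum_congr rfl fun j _ => ?_
    ring
  have h3 : ∑ j, ((‖B i j‖ ^ 2 : ℝ) : ℂ) * g (lam j) =
      ∑ j, ∑ m, B i j * g (lam j) * (U j m * star (V i m)) := by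
    refine Finset.sum_congr rfl fun j _ => ?_
    have h4 := congrArg star (sum_mul_star_eigenvectorUnitary hA B i j)
    rw [star_sum] at h4
    simp only [star_mul', star_star] at h4
    rw [← Finset.mul_sum]
    have h5 : ∑ m, U j m * star (V i m) = star (B i j) := by
      rw [← h4]
      exact Finset.sum_congr rfl fun m _ => mul_comm _ _
    rw [h5, Complex.star_def, mul_right_comm, Complex.mul_conj, Complex.normSq_eq_norm_sq]
  have h6 : matrixFun φ (Matrix.diagonal (fun i => (lam i : ℂ)) + B) i i - φ (lam i) - B i i * c
        - ∑ j, ((‖B i j‖ ^ 2 : ℝ) : ℂ) * g (lam j) =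
      ∑ j, ∑ m, B i j * (g (μ m) - g (lam j)) * (U j m * star (V i m)) := by
    rw [h1, h2, h3]
    simp only [mul_sub, sub_mul, Finset.sum_sub_distrib]
    ring
  rw [h6, Finset.mul_sum]
  refine (norm_sum_le _ _).trans (Finset.sum_le_sum fun j _ => ?_)
  have hK : 0 ≤ K := by
    have := (norm_nonneg _).trans (hg 0 1)
    simpa using this
  calc ‖∑ m, B i j * (g (μ m) - g (lam j)) * (U j m * star (V i m))‖
      ≤ ∑ m, (K * ‖B i j‖) * (‖V j m‖ * ‖V i m‖) := by
        refine (norm_sum_le _ _).trans (Finset.sum_le_sum fun m _ => ?_)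
        -- The Lipschitz bound produces `|μ m - lam j| ‖U j m‖`, which is `‖V j m‖`; no spectral gap
        -- or eigenvalue estimate is needed.
        rw [hV j m]
        simp only [norm_mul, norm_star, Complex.norm_real, Real.norm_eq_abs]
        have := mul_le_mul_of_nonneg_left (hg (μ m) (lam j))
          (by positivity : 0 ≤ ‖B i j‖ * (‖U j m‖ * ‖V i m‖))
        linarith
    _ ≤ (K * ‖B i j‖) * (√(∑ m, ‖V j m‖ ^ 2) * √(∑ m, ‖V i m‖ ^ 2)) := by
        rw [← Finset.mul_sum]
        exact mul_le_mul_of_nonneg_left (Real.sum_mul_le_sqrt_mul_sqrt _ _ _) (by positivity)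
    _ = _ := by
        rw [hVdef, sum_norm_sq_mul_eigenvectorUnitary, sum_norm_sq_mul_eigenvectorUnitary]
        ring

/-! ### Measurability of the entries of `φ(A)` -/

lemma pow_apply_eq_sum {A : Matrix (Fin n) (Fin n) ℂ} (hA : A.IsHermitian) (i : Fin n) (k : ℕ) :
    (A ^ k) i i = matrixFun (fun t => (t : ℂ) ^ k) A i i := by
  have h : ∀ m, ((A ^ k) * (hA.eigenvectorUnitary : Matrix (Fin n) (Fin n) ℂ)) i m =
      (hA.eigenvalues m : ℂ) ^ k * (hA.eigenvectorUnitary : Matrix (Fin n) (Fin n) ℂ) i m := by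
    intro m
    induction k with
    | zero => simp
    | succ k ih =>
      have h2 : A * (hA.eigenvectorUnitary : Matrix (Fin n) (Fin n) ℂ) =
          (hA.eigenvectorUnitary : Matrix (Fin n) (Fin n) ℂ) *
            Matrix.diagonal fun m => (hA.eigenvalues m : ℂ) := by
        ext j m
        rw [mul_eigenvectorUnitary, Matrix.mul_diagonal, mul_comm]
      rw [pow_succ, Matrix.mul_assoc, h2, ← Matrix.mul_assoc, Matrix.mul_diagonal, ih]
      ring
  rw [matrixFun_apply _ hA, ← sum_mul_star_eigenvectorUnitary hA (A ^ k) i i]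
  refine Finset.sum_congr rfl fun m _ => ?_
  rw [h m]
  ring

lemma measurable_pow_apply {Ω : Type*} [MeasurableSpace Ω] {A : Ω → Matrix (Fin n) (Fin n) ℂ}
    (hA : ∀ i j, Measurable fun ω => A ω i j) (k : ℕ) (i j : Fin n) :
    Measurable fun ω => (A ω ^ k) i j := by
  induction k generalizing j with
  | zero => simp
  | succ k ih =>
    simp only [pow_succ, Matrix.mul_apply]
    exact Finset.measurable_fun_sum _ fun m _ => (ih m).mul (hA m j)

lemma measurable_matrixFun_polynomial {Ω : Type*} [MeasurableSpace Ω]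
    {A : Ω → Matrix (Fin n) (Fin n) ℂ} (hA : ∀ i j, Measurable fun ω => A ω i j)
    (hH : ∀ ω, (A ω).IsHermitian) (p : Polynomial ℝ) (i : Fin n) :
    Measurable fun ω => matrixFun (fun t => ((p.eval t : ℝ) : ℂ)) (A ω) i i := by
  have h : ∀ ω, matrixFun (fun t => ((p.eval t : ℝ) : ℂ)) (A ω) i i =
      ∑ k ∈ Finset.range (p.natDegree + 1), (p.coeff k : ℂ) * (A ω ^ k) i i := by
    intro ω
    simp only [pow_apply_eq_sum (hH ω), matrixFun_apply _ (hH ω), Polynomial.eval_eq_sum_range,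
      Finset.mul_sum, Complex.ofReal_sum, Finset.sum_mul]
    rw [Finset.sum_comm]
    refine Finset.sum_congr rfl fun k _ => Finset.sum_congr rfl fun m _ => ?_
    push_cast
    ring
  simp only [h]
  exact Finset.measurable_fun_sum _ fun k _ => (measurable_pow_apply hA k i i).const_mul _

/-- This avoids any measurable choice of eigenvectors: a polynomial in `A` is a polynomial in its
entries, and a continuous function is a pointwise limit of polynomials. -/
lemma measurable_matrixFun_ofReal {Ω : Type*} [MeasurableSpace Ω]
    {A : Ω → Matrix (Fin n) (Fin n) ℂ} (hA : ∀ i j, Measurable fun ω => A ω i j)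
    (hH : ∀ ω, (A ω).IsHermitian) {ψ : ℝ → ℝ} (hψ : Continuous ψ) (i : Fin n) :
    Measurable fun ω => matrixFun (fun t => (ψ t : ℂ)) (A ω) i i := by
  -- Weierstrass on `[-k, k]` with error `1/(k+1)`: every fixed `t` eventually lies in the interval.
  have hp : ∀ k : ℕ, ∃ p : Polynomial ℝ, ∀ t ∈ Icc (-(k : ℝ)) k,
      |p.eval t - ψ t| < 1 / ((k : ℝ) + 1) := fun k =>
    exists_polynomial_near_of_continuousOn _ _ ψ hψ.continuousOn _ (by positivity)
  choose p hp using hp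
  have hlim : ∀ t, Tendsto (fun k => (p k).eval t) atTop (𝓝 (ψ t)) := by
    intro t
    rw [tendsto_iff_dist_tendsto_zero]
    refine squeeze_zero' (Eventually.of_forall fun _ => dist_nonneg) ?_
      tendsto_one_div_add_atTop_nhds_zero_nat
    filter_upwards [eventually_ge_atTop ⌈|t|⌉₊] with k hk
    have : |t| ≤ k := Nat.ceil_le.1 hk
    exact (hp k t (abs_le.1 this)).le
  refine measurable_of_tendsto_metrizable
    (fun k => measurable_matrixFun_polynomial hA hH (p k) i) ?_
  rw [tendsto_pi_nhds]
  intro ω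
  simp only [matrixFun_apply _ (hH ω)]
  exact tendsto_finsetSum _ fun m _ =>
    ((Complex.continuous_ofReal.tendsto _).comp (hlim _)).mul_const _

lemma measurable_matrixFun {Ω : Type*} [MeasurableSpace Ω]
    {A : Ω → Matrix (Fin n) (Fin n) ℂ} (hA : ∀ i j, Measurable fun ω => A ω i j)
    (hH : ∀ ω, (A ω).IsHermitian) {φ : ℝ → ℂ} (hφ : Continuous φ) (i : Fin n) :
    Measurable fun ω => matrixFun φ (A ω) i i := by
  have h : ∀ ω, matrixFun φ (A ω) i i = matrixFun (fun t => ((φ t).re : ℂ)) (A ω) i i +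
      Complex.I * matrixFun (fun t => ((φ t).im : ℂ)) (A ω) i i := by
    intro ω
    simp only [matrixFun_apply _ (hH ω), Finset.mul_sum, ← Finset.sum_add_distrib]
    refine Finset.sum_congr rfl fun m _ => ?_
    conv_lhs => rw [← Complex.re_add_im (φ _)]
    ring
  simp only [h]
  exact (measurable_matrixFun_ofReal hA hH (Complex.continuous_re.comp hφ) i).add
    ((measurable_matrixFun_ofReal hA hH (Complex.continuous_im.comp hφ) i).const_mul _)

end Spectral

/-! ### `Ξ` as an integral over `[0, 1]` -/

/-- The law of `f` has a density, hence no atoms. This discards the point `t = s`, where the literal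
quotient and `taylorQuotient` may differ. -/
lemma DensityHypotheses.ae_ne {f ρ : ℝ → ℝ} (h : DensityHypotheses f ρ) (s : ℝ) :
    ∀ᵐ y ∂volume.restrict (Icc (0 : ℝ) 1), f y ≠ s := by
  refine ae_of_ae_map (p := fun t => t ≠ s) h.f_aemeasurable ?_
  rw [h.map_eq]
  exact (withDensity_absolutelyContinuous _ _).ae_le (Measure.ae_ne volume s)

lemma VarianceHypotheses.ae_sq_eq {f : ℝ → ℝ} {σ τ : ℝ → ℝ → ℝ} (h : VarianceHypotheses f σ τ)
    {x : ℝ} (hx : x ∈ Icc (0 : ℝ) 1) :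
    ∀ᵐ y ∂volume.restrict (Icc (0 : ℝ) 1), τ (f x) (f y) = σ x y ^ 2 := by
  filter_upwards [ae_restrict_mem measurableSet_Icc, ae_restrict_of_ae (Measure.ae_ne volume x)]
    with y hy hne
  exact (h.σ_sq_eq x hx y hy hne.symm).symm

lemma quotient_eq_taylorQuotient {φ : ℝ → ℂ} (hφ : ContDiff ℝ 2 φ) {s t : ℝ} (h : t ≠ s) :
    (φ t - φ s - ((t - s : ℝ) : ℂ) * deriv φ s) / (((t - s) ^ 2 : ℝ) : ℂ) =
      taylorQuotient φ s t := by
  have h1 : ((t - s : ℝ) : ℂ) ≠ 0 := by exact_mod_cast sub_ne_zero.2 h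
  rw [Complex.ofReal_pow, div_eq_iff (pow_ne_zero 2 h1)]
  linear_combination taylor_eq hφ s t

/-- `Ξ_{f(x)}(φ)` converges absolutely and is an integral over `[0, 1]`. -/
lemma integrable_xiIntegrand_and_Xi_eq {f ρ : ℝ → ℝ} {σ τ : ℝ → ℝ → ℝ}
    (hc : DensityHypotheses f ρ) (hd : VarianceHypotheses f σ τ) {φ : ℝ → ℂ}
    (hφ : ContDiff ℝ 2 φ) {A V : ℝ} (hA : ∀ t, ‖iteratedDeriv 2 φ t‖ ≤ A)
    {x : ℝ} (hx : x ∈ Icc (0 : ℝ) 1) (hσ : ∀ y ∈ Icc (0 : ℝ) 1, σ x y ^ 2 ≤ V) :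
    Integrable (xiIntegrand τ ρ (f x) φ) ∧
      IntervalIntegrable (fun y => ((τ (f x) (f y) : ℝ) : ℂ) * taylorQuotient φ (f x) (f y))
        volume 0 1 ∧
      Xi τ ρ (f x) φ =
        ∫ y in (0 : ℝ)..1, ((τ (f x) (f y) : ℝ) : ℂ) * taylorQuotient φ (f x) (f y) := by
  set s := f x with hs
  have hA0 : 0 ≤ A := (norm_nonneg _).trans (hA 0)
  set q : ℝ → ℂ := fun t =>
    (φ t - φ s - ((t - s : ℝ) : ℂ) * deriv φ s) / (((t - s) ^ 2 : ℝ) : ℂ) with hq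
  set F : ℝ → ℂ := fun t => ((τ s t : ℝ) : ℂ) * q t with hF
  -- At `t = s` the quotient is `0 / 0 = 0`, so the bound persists there.
  have hqA : ∀ t, ‖q t‖ ≤ A := by
    intro t
    by_cases h : t = s
    · simpa [hq, h] using hA0
    · rw [hq]
      simp only
      rw [quotient_eq_taylorQuotient hφ h]
      exact norm_taylorQuotient_le hA s t
  have hφm : Measurable φ := hφ.continuous.measurable
  have hFm : Measurable F := by
    have := hd.τ_measurable s
    fun_prop
  -- `τ s` is controlled only along values of `f`, hence only almost everywhere for the push-forward
  -- measure.
  have hτ : ∀ᵐ t ∂(volume.restrict (Icc (0 : ℝ) 1)).map f, |τ s t| ≤ V := by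
    rw [ae_map_iff hc.f_aemeasurable
      (measurableSet_le (hd.τ_measurable s).abs measurable_const)]
    filter_upwards [hd.ae_sq_eq hx, ae_restrict_mem measurableSet_Icc] with y hy hyI
    rw [hy, abs_of_nonneg (sq_nonneg _)]
    exact hσ y hyI
  have hFint : Integrable F ((volume.restrict (Icc (0 : ℝ) 1)).map f) := by
    refine Integrable.of_bound hFm.aestronglyMeasurable (V * A) ?_
    filter_upwards [hτ] with t ht
    rw [hF, norm_mul, Complex.norm_real, Real.norm_eq_abs]
    exact mul_le_mul ht (hqA t) (norm_nonneg _) ((abs_nonneg _).trans ht)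
  have hρm : Measurable fun t => ENNReal.ofReal (ρ t) := hc.ρ_measurable.ennreal_ofReal
  have hρt : ∀ᵐ t, ENNReal.ofReal (ρ t) < ⊤ := ae_of_all _ fun t => ENNReal.ofReal_lt_top
  have hxi : (fun t => (ENNReal.ofReal (ρ t)).toReal • F t) = xiIntegrand τ ρ s φ := by
    funext t
    rw [ENNReal.toReal_ofReal (hc.ρ_nonneg t), xiIntegrand, Complex.real_smul, Complex.ofReal_mul]
    simp only [hF, hq]
    ring
  have hae : (fun y => F (f y)) =ᵐ[volume.restrict (Icc (0 : ℝ) 1)]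
      fun y => ((τ s (f y) : ℝ) : ℂ) * taylorQuotient φ s (f y) := by
    filter_upwards [hc.ae_ne s] with y hy
    rw [hF, hq]
    simp only
    rw [quotient_eq_taylorQuotient hφ hy]
  refine ⟨?_, ?_, ?_⟩
  · rw [← hxi, ← integrable_withDensity_iff_integrable_smul' hρm hρt, ← hc.map_eq]
    exact hFint
  · rw [intervalIntegrable_iff_integrableOn_Icc_of_le zero_le_one]
    exact (hFint.comp_aemeasurable hc.f_aemeasurable).congr hae
  · rw [intervalIntegral.integral_of_le zero_le_one, ← integral_Icc_eq_integral_Ioc,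
      ← integral_congr_ae hae, Xi, ← hxi, ← integral_withDensity_eq_integral_toReal_smul hρm hρt,
      ← hc.map_eq, integral_map hc.f_aemeasurable hFm.aestronglyMeasurable]

/-! ### Discretization error -/

/-- Comparison of an integral with a shifted Riemann sum. -/
lemma norm_riemann_sum_sub_integral_le {n : ℕ} (hn : n ≠ 0) {H : ℝ → ℂ} {c : ℕ → ℂ} {δ b : ℝ}
    (hδ : 0 ≤ δ) (hH : IntervalIntegrable H volume 0 1)
    (hb : ∀ᵐ y, y ∈ Icc (0 : ℝ) 1 → ‖H y‖ ≤ b) (hc : ∀ j < n, ‖c j‖ ≤ b)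
    (hHc : ∀ᵐ y, y ∈ Icc (0 : ℝ) 1 → ∀ j < n, j + 1 = ⌊(n : ℝ) * y⌋₊ → ‖H y - c j‖ ≤ δ) :
    ‖(1 / (n : ℂ)) * ∑ j ∈ Finset.range n, c j - ∫ y in (0 : ℝ)..1, H y‖ ≤
      δ + 2 * b * (1 / n) := by
  obtain ⟨m, rfl⟩ := Nat.exists_eq_succ_of_ne_zero hn
  set N : ℝ := ((m.succ : ℕ) : ℝ) with hN
  have hN0 : 0 < N := by positivity
  have hNm : N = m + 1 := by rw [hN]; push_cast; ring
  have hmem : ∀ k : ℕ, k ≤ m + 1 → (k : ℝ) / N ∈ Icc (0 : ℝ) 1 := fun k hk =>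
    ⟨by positivity, by
      rw [div_le_one hN0, hNm]
      exact_mod_cast hk⟩
  have hint : ∀ k < m + 1, IntervalIntegrable H volume ((k : ℕ) / N) ((k + 1 : ℕ) / N) := by
    intro k hk
    refine hH.mono_set ?_
    rw [uIcc_of_le zero_le_one]
    exact uIcc_subset_Icc (hmem k hk.le) (hmem (k + 1) hk)
  have hle : ∀ k : ℕ, (k : ℝ) / N ≤ ((k + 1 : ℕ) : ℝ) / N := fun k => by
    gcongr
    exact Nat.le_succ k
  have hlen : ∀ k : ℕ, ((k + 1 : ℕ) : ℝ) / N - (k : ℝ) / N = 1 / N := fun k => by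
    push_cast
    ring
  have hsum := intervalIntegral.sum_integral_adjacent_intervals (f := H) (μ := volume)
    (a := fun k : ℕ => (k : ℝ) / N) hint
  simp only [Nat.cast_zero, zero_div] at hsum
  rw [show ((m + 1 : ℕ) : ℝ) / N = 1 from div_self hN0.ne'] at hsum
  -- The index `j` stands for `j + 1`, so `c j` is compared with `H` on the cell from `(j+1)/N` to
  -- `(j+2)/N`. The first cell and the last coefficient `c m` have no partner; each costs `b/N`.
  have hterm : ∀ j ∈ Finset.range m,
      ‖1 / (m.succ : ℂ) * c j - ∫ y in ((j + 1 : ℕ) : ℝ) / N..((j + 1 + 1 : ℕ) : ℝ) / N, H y‖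
        ≤ δ * (1 / N) := by
    intro j hj
    have hj' : j < m := Finset.mem_range.1 hj
    have h1 : 1 / (m.succ : ℂ) * c j =
        ∫ _ in ((j + 1 : ℕ) : ℝ) / N..((j + 1 + 1 : ℕ) : ℝ) / N, c j := by
      rw [intervalIntegral.integral_const, hlen, Complex.real_smul]
      rw [hN]
      push_cast
      ring
    rw [h1, norm_sub_rev, ← intervalIntegral.integral_sub (hint (j + 1) (by omega))
      intervalIntegrable_const]
    refine (intervalIntegral.norm_integral_le_of_norm_le_const_ae (C := δ) ?_).trans ?_
    -- The right endpoint is excluded because the floor jumps there.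
    · filter_upwards [hHc, Measure.ae_ne volume (((j + 1 + 1 : ℕ) : ℝ) / N)] with y hy hne hyI
      rw [uIoc_of_le (hle (j + 1))] at hyI
      refine hy ⟨(hmem (j + 1) (by omega)).1.trans hyI.1.le,
        hyI.2.trans (hmem (j + 1 + 1) (by omega)).2⟩ j (by omega) ?_
      symm
      rw [Nat.floor_eq_iff (mul_nonneg hN0.le ((hmem (j + 1) (by omega)).1.trans hyI.1.le))]
      have h2 := hyI.1
      have h3 := lt_of_le_of_ne hyI.2 hne
      rw [div_lt_iff₀' hN0] at h2
      rw [lt_div_iff₀' hN0] at h3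
      push_cast at h2 h3 ⊢
      exact ⟨h2.le, h3⟩
    · rw [hlen, abs_of_pos (by positivity)]
  have hfirst : ‖∫ y in ((0 : ℕ) : ℝ) / N..((0 + 1 : ℕ) : ℝ) / N, H y‖ ≤ b * (1 / N) := by
    refine (intervalIntegral.norm_integral_le_of_norm_le_const_ae (C := b) ?_).trans ?_
    · filter_upwards [hb] with y hy hyI
      rw [uIoc_of_le (hle 0)] at hyI
      exact hy ⟨(hmem 0 (by omega)).1.trans hyI.1.le, hyI.2.trans (hmem (0 + 1) (by omega)).2⟩
    · rw [hlen, abs_of_pos (by positivity)]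
  have hlast : ‖1 / (m.succ : ℂ) * c m‖ ≤ b * (1 / N) := by
    rw [norm_mul, norm_div, norm_one, Complex.norm_natCast, mul_comm]
    exact mul_le_mul_of_nonneg_right (hc m (Nat.lt_succ_self m)) (by positivity)
  have hdecomp : (1 / (m.succ : ℂ)) * ∑ j ∈ Finset.range m.succ, c j -
      ∫ y in (0 : ℝ)..1, H y =
      ∑ j ∈ Finset.range m, (1 / (m.succ : ℂ) * c j -
        ∫ y in ((j + 1 : ℕ) : ℝ) / N..((j + 1 + 1 : ℕ) : ℝ) / N, H y) +
      (1 / (m.succ : ℂ) * c m - ∫ y in ((0 : ℕ) : ℝ) / N..((0 + 1 : ℕ) : ℝ) / N, H y) := by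
    rw [← hsum, Finset.sum_range_succ, Finset.sum_range_succ', Finset.sum_sub_distrib,
      ← Finset.mul_sum]
    simp only [Nat.cast_zero, zero_div]
    ring
  rw [hdecomp]
  calc _ ≤ ∑ j ∈ Finset.range m, δ * (1 / N) + (b * (1 / N) + b * (1 / N)) :=
        (norm_add_le _ _).trans (add_le_add ((norm_sum_le _ _).trans (Finset.sum_le_sum hterm))
          ((norm_sub_le _ _).trans (add_le_add hlast hfirst)))
    _ ≤ δ + 2 * b * (1 / N) := by
        rw [Finset.sum_const, Finset.card_range, nsmul_eq_mul]
        have : (m : ℝ) * (1 / N) ≤ 1 := by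
          rw [mul_one_div, div_le_one hN0, hNm]
          linarith
        nlinarith

/-- A real `sSup` bounds its set only if that set is bounded above; finiteness of `Fin n` and
boundedness of `f` and `σ` provide this. -/
lemma exists_eta_eq_add {Ω : Type*} [MeasurableSpace Ω] (P : Measure Ω) {n : ℕ}
    (lam : Fin n → ℝ) (ξ : Ω → Matrix (Fin n) (Fin n) ℂ) {f : ℝ → ℝ} {σ : ℝ → ℝ → ℝ}
    (hf : ∃ M : ℝ, ∀ x ∈ Icc (0 : ℝ) 1, |f x| ≤ M)
    (hσ : ∃ M : ℝ, ∀ x ∈ Icc (0 : ℝ) 1, ∀ y ∈ Icc (0 : ℝ) 1, |σ x y| ≤ M) :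
    ∃ a b : ℝ, 0 ≤ a ∧ 0 ≤ b ∧ eta P lam ξ f σ = a + b ∧
      (∀ x ∈ Icc (0 : ℝ) 1, ∀ i : Fin n, IsFloorIndex n x i → |lam i - f x| ≤ a) ∧
      (∀ x ∈ Icc (0 : ℝ) 1, ∀ y ∈ Icc (0 : ℝ) 1, ∀ i j : Fin n, IsFloorIndex n x i →
        IsFloorIndex n y j → |entryVariance P ξ i j - σ x y ^ 2| ≤ b) := by
  obtain ⟨M, hM⟩ := hf
  obtain ⟨M', hM'⟩ := hσ
  refine ⟨_, _, ?_, ?_, rfl, ?_, ?_⟩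
  · exact Real.sSup_nonneg (by rintro r ⟨x, -, i, -, rfl⟩; exact abs_nonneg _)
  · exact Real.sSup_nonneg (by rintro r ⟨x, -, y, -, i, j, -, -, rfl⟩; exact abs_nonneg _)
  · intro x hx i hi
    refine le_csSup ⟨(∑ k, |lam k|) + M, ?_⟩ ⟨x, hx, i, hi, rfl⟩
    rintro r ⟨y, hy, k, -, rfl⟩
    exact (abs_sub _ _).trans (add_le_add
      (Finset.single_le_sum (f := fun k => |lam k|) (fun _ _ => abs_nonneg _)
        (Finset.mem_univ k)) (hM y hy))
  · intro x hx y hy i j hi hj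
    refine le_csSup ⟨(∑ p : Fin n × Fin n, |entryVariance P ξ p.1 p.2|) + M' ^ 2, ?_⟩
      ⟨x, hx, y, hy, i, j, hi, hj, rfl⟩
    rintro r ⟨x, hx, y, hy, k, l, -, -, rfl⟩
    refine (abs_sub _ _).trans (add_le_add
      (Finset.single_le_sum (f := fun p : Fin n × Fin n => |entryVariance P ξ p.1 p.2|)
        (fun _ _ => abs_nonneg _) (Finset.mem_univ (k, l))) ?_)
    rw [abs_pow]
    exact pow_le_pow_left₀ (abs_nonneg _) (hM' x hx y hy) 2

/-- The deterministic part of the remainder. -/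
lemma norm_variance_sum_sub_Xi_le {Ω : Type*} [MeasurableSpace Ω] (P : Measure Ω) {n : ℕ}
    {lam : Fin n → ℝ} {ξ : Ω → Matrix (Fin n) (Fin n) ℂ}
    {f ρ : ℝ → ℝ} {σ τ : ℝ → ℝ → ℝ}
    (hf : ∃ M : ℝ, ∀ x ∈ Icc (0 : ℝ) 1, |f x| ≤ M)
    (hσ : ∃ M : ℝ, ∀ x ∈ Icc (0 : ℝ) 1, ∀ y ∈ Icc (0 : ℝ) 1, |σ x y| ≤ M)
    (hc : DensityHypotheses f ρ) (hd : VarianceHypotheses f σ τ) {φ : ℝ → ℂ}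
    (hφ : ContDiff ℝ 3 φ) {A V : ℝ} (hA2 : ∀ t, ‖iteratedDeriv 2 φ t‖ ≤ A)
    (hA3 : ∀ t, ‖iteratedDeriv 3 φ t‖ ≤ A)
    {x : ℝ} (hx : x ∈ Icc (0 : ℝ) 1) (hσV : ∀ y ∈ Icc (0 : ℝ) 1, σ x y ^ 2 ≤ V)
    {i : Fin n} (hi : IsFloorIndex n x i)
    (hvar : ∀ j, 0 ≤ entryVariance P ξ i j ∧ entryVariance P ξ i j ≤ V) :
    ‖(1 / (n : ℂ)) * ∑ j, (entryVariance P ξ i j : ℂ) * taylorQuotient φ (lam i) (lam j)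
      - Xi τ ρ (f x) φ‖ ≤ A * ((1 + 2 * V) * eta P lam ξ f σ + 2 * V * (1 / n)) := by
  have hφ2 : ContDiff ℝ 2 φ := hφ.of_le (by norm_num)
  have hA0 : 0 ≤ A := (norm_nonneg _).trans (hA2 0)
  have hV0 : 0 ≤ V := (hvar i).1.trans (hvar i).2
  obtain ⟨-, hint, hXi⟩ := integrable_xiIntegrand_and_Xi_eq hc hd hφ2 hA2 hx hσV
  obtain ⟨a, b, ha, hb, hη, hlam, hent⟩ := exists_eta_eq_add P lam ξ hf hσ
  have hn : n ≠ 0 := fun h => by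
    subst h
    exact i.elim0
  set c : ℕ → ℂ := fun j => if h : j < n then
    (entryVariance P ξ i ⟨j, h⟩ : ℂ) * taylorQuotient φ (lam i) (lam ⟨j, h⟩) else 0 with hcdef
  have hcsum : ∑ j, (entryVariance P ξ i j : ℂ) * taylorQuotient φ (lam i) (lam j) =
      ∑ j ∈ Finset.range n, c j := by
    rw [Finset.sum_range]
    refine Finset.sum_congr rfl fun j _ => ?_
    simp [hcdef]
  have hτ : ∀ᵐ y, y ∈ Icc (0 : ℝ) 1 → τ (f x) (f y) = σ x y ^ 2 :=
    (ae_restrict_iff' measurableSet_Icc).1 (hd.ae_sq_eq hx)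
  rw [hcsum, hXi]
  refine (norm_riemann_sum_sub_integral_le hn (δ := A * ((1 + 2 * V) * (a + b))) (b := V * A)
    (by positivity) hint ?_ ?_ ?_).trans (le_of_eq ?_)
  · filter_upwards [hτ] with y hy hyI
    rw [hy hyI, norm_mul, Complex.norm_real, Real.norm_of_nonneg (sq_nonneg _)]
    exact mul_le_mul (hσV y hyI) (norm_taylorQuotient_le hA2 _ _) (norm_nonneg _) hV0
  · intro j hj
    rw [hcdef]
    simp only [hj, dif_pos]
    rw [norm_mul, Complex.norm_real, Real.norm_of_nonneg (hvar _).1]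
    exact mul_le_mul (hvar _).2 (norm_taylorQuotient_le hA2 _ _) (norm_nonneg _) hV0
  · filter_upwards [hτ] with y hy hyI j hj hjy
    rw [hy hyI, hcdef]
    simp only [hj, dif_pos]
    set v := entryVariance P ξ i ⟨j, hj⟩ with hv
    have hdec : ((σ x y ^ 2 : ℝ) : ℂ) * taylorQuotient φ (f x) (f y) -
        (v : ℂ) * taylorQuotient φ (lam i) (lam ⟨j, hj⟩) =
        ((σ x y ^ 2 : ℝ) : ℂ) *
          (taylorQuotient φ (f x) (f y) - taylorQuotient φ (lam i) (lam ⟨j, hj⟩)) +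
        ((σ x y ^ 2 - v : ℝ) : ℂ) * taylorQuotient φ (lam i) (lam ⟨j, hj⟩) := by
      push_cast
      ring
    rw [hdec]
    refine (norm_add_le _ _).trans ?_
    rw [norm_mul, norm_mul, Complex.norm_real, Complex.norm_real,
      Real.norm_of_nonneg (sq_nonneg _), Real.norm_eq_abs]
    have h1 := norm_taylorQuotient_sub_le hφ hA3 (f x) (f y) (lam i) (lam ⟨j, hj⟩)
    have h2 := hlam x hx i hi
    have h3 := hlam y hyI ⟨j, hj⟩ hjy
    have h4 := hent x hx y hyI i ⟨j, hj⟩ hi hjy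
    rw [abs_sub_comm] at h2 h3 h4
    have h5 : ‖taylorQuotient φ (f x) (f y) - taylorQuotient φ (lam i) (lam ⟨j, hj⟩)‖ ≤
        A * (2 * a) := h1.trans (mul_le_mul_of_nonneg_left (by linarith) hA0)
    have h6 := mul_le_mul (hσV y hyI) h5 (norm_nonneg _) hV0
    have h7 := mul_le_mul h4 (norm_taylorQuotient_le hA2 (lam i) (lam ⟨j, hj⟩))
      (norm_nonneg _) hb
    have h8 : 0 ≤ A * a := by positivity
    have h9 : 0 ≤ V * (A * b) := by positivity
    nlinarith
  · rw [hη]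
    ring

/-! ### Moment estimates -/

lemma eLpNorm_two_le_of_sq_le {Ω E : Type*} [MeasurableSpace Ω] [NormedAddCommGroup E]
    {P : Measure Ω} {F : Ω → E} {G : Ω → ℝ} {c : ℝ} (hFG : ∀ ω, ‖F ω‖ ^ 2 ≤ G ω)
    (hG : Integrable G P) (hc0 : 0 ≤ c) (hc : ∫ ω, G ω ∂P ≤ c ^ 2) :
    eLpNorm F 2 P ≤ ENNReal.ofReal c := by
  have h : ∫⁻ ω, ‖F ω‖ₑ ^ (2 : ℝ) ∂P ≤ ENNReal.ofReal c ^ (2 : ℝ) := by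
    calc ∫⁻ ω, ‖F ω‖ₑ ^ (2 : ℝ) ∂P ≤ ∫⁻ ω, ENNReal.ofReal (G ω) ∂P := by
          refine lintegral_mono fun ω => ?_
          rw [← ofReal_norm, ENNReal.rpow_two, ← ENNReal.ofReal_pow (norm_nonneg _)]
          exact ENNReal.ofReal_le_ofReal (hFG ω)
      _ = ENNReal.ofReal (∫ ω, G ω ∂P) :=
          (ofReal_integral_eq_lintegral_ofReal hG
            (ae_of_all _ fun ω => (sq_nonneg _).trans (hFG ω))).symm
      _ ≤ _ := by
          rw [ENNReal.rpow_two, ← ENNReal.ofReal_pow hc0]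
          exact ENNReal.ofReal_le_ofReal hc
  rw [eLpNorm_eq_lintegral_rpow_enorm_toReal (by norm_num) (by norm_num), ENNReal.toReal_ofNat,
    one_div]
  exact (ENNReal.rpow_inv_le_iff (by norm_num)).2 h

/-- Cauchy–Schwarz over `j` gives the factor `n`, and the inequality `pqr ≤ p³ + q³ + r³` for
squares gives sixth powers. Products of dependent entries are thereby handled without independence.
-/
lemma sq_sum_mul_sqrt_mul_sqrt_le {n : ℕ} (b : Fin n → Fin n → ℝ) (i : Fin n) :
    (∑ j, b i j * (√(∑ k, b j k ^ 2) * √(∑ k, b i k ^ 2))) ^ 2 ≤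
      n * ∑ j, ∑ k, ∑ l, (b i j ^ 6 + b j k ^ 6 + b i l ^ 6) := by
  refine (sq_sum_le_card_mul_sum_sq).trans ?_
  rw [Finset.card_univ, Fintype.card_fin]
  refine mul_le_mul_of_nonneg_left (Finset.sum_le_sum fun j _ => ?_) (Nat.cast_nonneg n)
  have h0 : ∀ j, 0 ≤ ∑ k, b j k ^ 2 := fun j => Finset.sum_nonneg fun _ _ => sq_nonneg _
  rw [mul_pow, mul_pow, Real.sq_sqrt (h0 j), Real.sq_sqrt (h0 i), Finset.sum_mul_sum,
    Finset.mul_sum]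
  refine Finset.sum_le_sum fun k _ => ?_
  rw [Finset.mul_sum]
  refine Finset.sum_le_sum fun l _ => ?_
  have amgm : ∀ p q r : ℝ, 0 ≤ p → 0 ≤ q → 0 ≤ r → p * (q * r) ≤ p ^ 3 + q ^ 3 + r ^ 3 := by
    intro p q r hp hq hr
    nlinarith [mul_nonneg hp (sq_nonneg (q - r)), mul_nonneg hq (sq_nonneg (p - r)),
      mul_nonneg hr (sq_nonneg (p - q)), mul_nonneg (add_nonneg hp hq) (sq_nonneg (p - q)),
      mul_nonneg (add_nonneg hq hr) (sq_nonneg (q - r)),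
      mul_nonneg (add_nonneg hp hr) (sq_nonneg (p - r)), pow_nonneg hp 3, pow_nonneg hq 3,
      pow_nonneg hr 3]
  have := amgm (b i j ^ 2) (b j k ^ 2) (b i l ^ 2) (sq_nonneg _) (sq_nonneg _) (sq_nonneg _)
  simpa only [← pow_mul] using this

section Moments

variable {Ω : Type*} [MeasurableSpace Ω] {P : Measure Ω}

lemma integrable_pow_six {X : Ω → ℂ} (hX : Measurable X) {M : NNReal}
    (hM : ∫⁻ ω, ‖X ω‖ₑ ^ 6 ∂P ≤ M) :
    Integrable (fun ω => ‖X ω‖ ^ 6) P ∧ ∫ ω, ‖X ω‖ ^ 6 ∂P ≤ M := by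
  have h0 : ∀ ω, ‖X ω‖ₑ ^ 6 = ENNReal.ofReal (‖X ω‖ ^ 6) := fun ω => by
    rw [ENNReal.ofReal_pow (norm_nonneg _), ofReal_norm]
  simp only [h0] at hM
  have hm : AEStronglyMeasurable (fun ω => ‖X ω‖ ^ 6) P := by fun_prop
  have hnn : 0 ≤ᵐ[P] fun ω => ‖X ω‖ ^ 6 := ae_of_all _ fun ω => by positivity
  refine ⟨⟨hm, ?_⟩, ?_⟩
  · rw [hasFiniteIntegral_iff_ofReal hnn]
    exact hM.trans_lt ENNReal.coe_lt_top
  · rw [integral_eq_lintegral_of_nonneg_ae hnn hm]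
    exact ENNReal.toReal_le_of_le_ofReal M.2 (by simpa using hM)

variable {n : ℕ} {ξ : Ω → Matrix (Fin n) (Fin n) ℂ}

/-- Row `i` crosses the diagonal, so each entry is moved to its representative in the upper
triangle; the modulus is unchanged by conjugation. -/
lemma indepFun_row (hH : ∀ ω, (ξ ω).IsHermitian)
    (hind : iIndepFun
      (fun (p : {p : Fin n × Fin n // p.1 ≤ p.2}) (ω : Ω) => ξ ω p.1.1 p.1.2) P)
    (w : Fin n → ℝ) (i : Fin n) {j k : Fin n} (hjk : j ≠ k) :
    IndepFun (fun ω => w j * ‖ξ ω i j‖ ^ 2) (fun ω => w k * ‖ξ ω i k‖ ^ 2) P := by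
  let p : Fin n → {p : Fin n × Fin n // p.1 ≤ p.2} := fun j => ⟨(min i j, max i j), min_le_max⟩
  have hp : p j ≠ p k := by
    intro h
    have h1 : min i j = min i k := congrArg (fun q => q.1.1) h
    have h2 : max i j = max i k := congrArg (fun q => q.1.2) h
    apply hjk
    rcases le_total i j with ha | ha <;> rcases le_total i k with hb | hb <;>
      simp only [min_eq_left, min_eq_right, max_eq_left, max_eq_right, ha, hb] at h1 h2
    · exact h2
    · rw [h2, h1]
    · rw [h1, h2]
    · exact h1
  have hnorm : ∀ j ω, ‖ξ ω (p j).1.1 (p j).1.2‖ = ‖ξ ω i j‖ := by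
    intro j ω
    rcases le_total i j with h | h
    · simp [p, h]
    · simp only [p, min_eq_right h, max_eq_left h]
      rw [← (hH ω).apply i j, norm_star]
  have := (hind.indepFun hp).comp (φ := fun z : ℂ => w j * ‖z‖ ^ 2)
    (ψ := fun z : ℂ => w k * ‖z‖ ^ 2) (by fun_prop) (by fun_prop)
  simpa only [Function.comp_def, hnorm] using this

lemma integral_sum_pow_six_le (hm : ∀ i j, Measurable fun ω => ξ ω i j)
    {M : NNReal} (hM : ∀ i j, ∫⁻ ω, ‖ξ ω i j‖ₑ ^ 6 ∂P ≤ M) (i : Fin n) :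
    Integrable (fun ω => ∑ j, ∑ k, ∑ l, (‖ξ ω i j‖ ^ 6 + ‖ξ ω j k‖ ^ 6 + ‖ξ ω i l‖ ^ 6)) P ∧
    ∫ ω, ∑ j, ∑ k, ∑ l, (‖ξ ω i j‖ ^ 6 + ‖ξ ω j k‖ ^ 6 + ‖ξ ω i l‖ ^ 6) ∂P ≤
      (n : ℝ) ^ 3 * (3 * M) := by
  have h : ∀ i j, Integrable (fun ω => ‖ξ ω i j‖ ^ 6) P ∧ ∫ ω, ‖ξ ω i j‖ ^ 6 ∂P ≤ M :=
    fun i j => integrable_pow_six (hm i j) (hM i j)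
  have h3 : ∀ j k l, Integrable
      (fun ω => ‖ξ ω i j‖ ^ 6 + ‖ξ ω j k‖ ^ 6 + ‖ξ ω i l‖ ^ 6) P := fun j k l =>
    ((h i j).1.add (h j k).1).add (h i l).1
  have h2 : ∀ j k, Integrable
      (fun ω => ∑ l, (‖ξ ω i j‖ ^ 6 + ‖ξ ω j k‖ ^ 6 + ‖ξ ω i l‖ ^ 6)) P := fun j k =>
    integrable_finsetSum _ fun l _ => h3 j k l
  have h1 : ∀ j, Integrable
      (fun ω => ∑ k, ∑ l, (‖ξ ω i j‖ ^ 6 + ‖ξ ω j k‖ ^ 6 + ‖ξ ω i l‖ ^ 6)) P := fun j =>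
    integrable_finsetSum _ fun k _ => h2 j k
  refine ⟨integrable_finsetSum _ fun j _ => h1 j, ?_⟩
  rw [integral_finsetSum _ fun j _ => h1 j]
  calc _ ≤ ∑ _j : Fin n, ∑ _k : Fin n, ∑ _l : Fin n, (3 * M : ℝ) := by
        refine Finset.sum_le_sum fun j _ => ?_
        rw [integral_finsetSum _ fun k _ => h2 j k]
        refine Finset.sum_le_sum fun k _ => ?_
        rw [integral_finsetSum _ fun l _ => h3 j k l]
        refine Finset.sum_le_sum fun l _ => ?_
        have h12 : Integrable (fun ω => ‖ξ ω i j‖ ^ 6 + ‖ξ ω j k‖ ^ 6) P := (h i j).1.add (h j k).1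
        rw [integral_add h12 (h i l).1, integral_add (h i j).1 (h j k).1]
        linarith [(h i j).2, (h j k).2, (h i l).2]
    _ = _ := by
        simp only [Finset.sum_const, Finset.card_univ, Fintype.card_fin, nsmul_eq_mul]
        ring

variable [IsProbabilityMeasure P]

lemma integrable_pow_of_le_six {X : Ω → ℂ} (hX : Measurable X) {M : NNReal}
    (hM : ∫⁻ ω, ‖X ω‖ₑ ^ 6 ∂P ≤ M) {k : ℕ} (hk : k ≤ 6) :
    Integrable (fun ω => ‖X ω‖ ^ k) P ∧ ∫ ω, ‖X ω‖ ^ k ∂P ≤ 1 + M := by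
  obtain ⟨h6, h6M⟩ := integrable_pow_six hX hM
  have hle : ∀ ω, ‖X ω‖ ^ k ≤ 1 + ‖X ω‖ ^ 6 := by
    intro ω
    rcases le_total (‖X ω‖) 1 with h | h
    · exact (pow_le_one₀ (norm_nonneg _) h).trans (by simp)
    · exact (pow_le_pow_right₀ h hk).trans (by simp)
  have hi : Integrable (fun ω => 1 + ‖X ω‖ ^ 6) P := (integrable_const _).add h6
  have hki : Integrable (fun ω => ‖X ω‖ ^ k) P :=
    hi.mono' (by fun_prop) (ae_of_all _ fun ω => by
      rw [Real.norm_of_nonneg (by positivity)]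
      exact hle ω)
  refine ⟨hki, (integral_mono hki hi hle).trans ?_⟩
  rw [integral_add (integrable_const _) h6]
  simpa using h6M

/-- Variances of independent terms add, and each is at most `w j ^ 2` times a fourth moment. -/
lemma integral_sq_sum_le (hm : ∀ i j, Measurable fun ω => ξ ω i j)
    (hH : ∀ ω, (ξ ω).IsHermitian)
    (hind : iIndepFun
      (fun (p : {p : Fin n × Fin n // p.1 ≤ p.2}) (ω : Ω) => ξ ω p.1.1 p.1.2) P)
    {M : NNReal} (hM : ∀ i j, ∫⁻ ω, ‖ξ ω i j‖ₑ ^ 6 ∂P ≤ M) (w : Fin n → ℝ) (i : Fin n) :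
    Integrable (fun ω => (∑ j, w j * (‖ξ ω i j‖ ^ 2 - entryVariance P ξ i j)) ^ 2) P ∧
    ∫ ω, (∑ j, w j * (‖ξ ω i j‖ ^ 2 - entryVariance P ξ i j)) ^ 2 ∂P ≤
      (∑ j, w j ^ 2) * (1 + M) := by
  set X : Fin n → Ω → ℝ := fun j ω => w j * ‖ξ ω i j‖ ^ 2 with hX
  have hsq : ∀ j ω, X j ω ^ 2 = w j ^ 2 * ‖ξ ω i j‖ ^ 4 := fun j ω => by
    simp only [hX]
    ring
  have hXL : ∀ j, MemLp (X j) 2 P := by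
    intro j
    have := hm i j
    rw [memLp_two_iff_integrable_sq (by fun_prop)]
    simp only [hsq]
    exact (integrable_pow_of_le_six (hm i j) (hM i j) (by norm_num)).1.const_mul _
  have hSL : MemLp (∑ j, X j) 2 P := memLp_finsetSum' _ fun j _ => hXL j
  have hmean : ∫ ω, (∑ j, X j) ω ∂P = ∑ j, w j * entryVariance P ξ i j := by
    simp only [Finset.sum_apply]
    rw [integral_finsetSum _ fun j _ => (hXL j).integrable (by norm_num)]
    refine Finset.sum_congr rfl fun j _ => ?_
    rw [hX, integral_const_mul, entryVariance]
  have heq : ∀ ω, (∑ j, w j * (‖ξ ω i j‖ ^ 2 - entryVariance P ξ i j)) =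
      (∑ j, X j) ω - ∫ ω, (∑ j, X j) ω ∂P := by
    intro ω
    rw [hmean, Finset.sum_apply, ← Finset.sum_sub_distrib]
    exact Finset.sum_congr rfl fun j _ => mul_sub _ _ _
  simp only [heq]
  refine ⟨(hSL.sub (memLp_const _)).integrable_sq, ?_⟩
  rw [← variance_eq_integral hSL.aestronglyMeasurable.aemeasurable,
    IndepFun.variance_sum (fun j _ => hXL j)
      (fun j _ k _ hjk => indepFun_row hH hind w i hjk), Finset.sum_mul]
  refine Finset.sum_le_sum fun j _ => ?_
  refine (variance_le_expectation_sq (hXL j).aestronglyMeasurable).trans ?_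
  simp only [Pi.pow_apply, hsq]
  rw [integral_const_mul]
  exact mul_le_mul_of_nonneg_left
    (integrable_pow_of_le_six (hm i j) (hM i j) (by norm_num)).2 (sq_nonneg _)

lemma integral_norm_sq_sum_le (hm : ∀ i j, Measurable fun ω => ξ ω i j)
    (hH : ∀ ω, (ξ ω).IsHermitian)
    (hind : iIndepFun
      (fun (p : {p : Fin n × Fin n // p.1 ≤ p.2}) (ω : Ω) => ξ ω p.1.1 p.1.2) P)
    {M : NNReal} (hM : ∀ i j, ∫⁻ ω, ‖ξ ω i j‖ₑ ^ 6 ∂P ≤ M) (z : Fin n → ℂ) (i : Fin n) :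
    Integrable (fun ω =>
      ‖∑ j, ((‖ξ ω i j‖ ^ 2 - entryVariance P ξ i j : ℝ) : ℂ) * z j‖ ^ 2) P ∧
    ∫ ω, ‖∑ j, ((‖ξ ω i j‖ ^ 2 - entryVariance P ξ i j : ℝ) : ℂ) * z j‖ ^ 2 ∂P ≤
      (∑ j, ‖z j‖ ^ 2) * (1 + M) := by
  have heq : ∀ ω, ‖∑ j, ((‖ξ ω i j‖ ^ 2 - entryVariance P ξ i j : ℝ) : ℂ) * z j‖ ^ 2 =
      (∑ j, (z j).re * (‖ξ ω i j‖ ^ 2 - entryVariance P ξ i j)) ^ 2 +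
      (∑ j, (z j).im * (‖ξ ω i j‖ ^ 2 - entryVariance P ξ i j)) ^ 2 := by
    intro ω
    rw [← Complex.normSq_eq_norm_sq, Complex.normSq_apply, Complex.re_sum, Complex.im_sum]
    simp only [Complex.re_ofReal_mul, Complex.im_ofReal_mul]
    simp only [mul_comm (z _).re, mul_comm (z _).im]
    ring
  obtain ⟨h1, h2⟩ := integral_sq_sum_le hm hH hind hM (fun j => (z j).re) i
  obtain ⟨h3, h4⟩ := integral_sq_sum_le hm hH hind hM (fun j => (z j).im) i
  simp only [heq]
  refine ⟨h1.add h3, ?_⟩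
  rw [integral_add h1 h3]
  refine (add_le_add h2 h4).trans (le_of_eq ?_)
  rw [← add_mul, ← Finset.sum_add_distrib]
  congr 1
  refine Finset.sum_congr rfl fun j _ => ?_
  rw [← Complex.normSq_eq_norm_sq, Complex.normSq_apply]
  ring

end Moments

/-! ### Assembling the remainder -/

lemma perturbed_isHermitian {n : ℕ} (lam : Fin n → ℝ) (ε : ℝ) {ξ : Matrix (Fin n) (Fin n) ℂ}
    (hξ : ξ.IsHermitian) : (perturbed lam ε ξ).IsHermitian := by
  refine Matrix.IsHermitian.add ?_ ?_
  · exact Matrix.isHermitian_diagonal_of_self_adjoint _ (by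
      ext i
      simp)
  · unfold Matrix.IsHermitian
    rw [Matrix.conjTranspose_smul, Matrix.conjTranspose_smul, hξ.eq]
    simp only [Complex.star_def, Complex.conj_ofReal]

lemma measurable_remainder {Ω : Type*} [MeasurableSpace Ω] {n : ℕ} (lam : Fin n → ℝ) (ε : ℝ)
    (τ : ℝ → ℝ → ℝ) (ρ : ℝ → ℝ) (s : ℝ) {φ : ℝ → ℂ} (hφ : Continuous φ) (i : Fin n)
    {ξ : Ω → Matrix (Fin n) (Fin n) ℂ} (hm : ∀ i j, Measurable fun ω => ξ ω i j)
    (hH : ∀ ω, (ξ ω).IsHermitian) :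
    Measurable fun ω => remainder lam ε τ ρ s φ i (ξ ω) := by
  have h1 : Measurable fun ω => matrixFun φ (perturbed lam ε (ξ ω)) i i := by
    refine measurable_matrixFun (fun j k => ?_) (fun ω => perturbed_isHermitian lam ε (hH ω)) hφ i
    simp only [perturbed, Matrix.add_apply, Matrix.smul_apply, smul_eq_mul]
    exact measurable_const.add (((hm j k).const_mul _).const_mul _)
  have h2 : Measurable fun ω => φ (lam i + ε / √(n : ℝ) * (ξ ω i i).re) :=
    hφ.measurable.comp (((Complex.measurable_re.comp (hm i i)).const_mul _).const_add _)
  exact (h1.sub h2).sub measurable_const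

lemma norm_sq_add_four_le (a b c d : ℂ) :
    ‖a + b + c + d‖ ^ 2 ≤ 4 * (‖a‖ ^ 2 + ‖b‖ ^ 2 + ‖c‖ ^ 2 + ‖d‖ ^ 2) := by
  have h : ‖a + b + c + d‖ ≤ ‖a‖ + ‖b‖ + ‖c‖ + ‖d‖ :=
    (norm_add_le _ _).trans (add_le_add_left ((norm_add_le _ _).trans
      (add_le_add_left (norm_add_le _ _) _)) _)
  have h2 := pow_le_pow_left₀ (norm_nonneg _) h 2
  nlinarith [sq_nonneg (‖a‖ - ‖b‖), sq_nonneg (‖a‖ - ‖c‖), sq_nonneg (‖a‖ - ‖d‖),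
    sq_nonneg (‖b‖ - ‖c‖), sq_nonneg (‖b‖ - ‖d‖), sq_nonneg (‖c‖ - ‖d‖)]

/-- The remainder splits into a third order term, a centred fluctuation, a deterministic
discretization error, and the contribution of the diagonal entry. -/
lemma norm_sq_remainder_le {n : ℕ} (lam : Fin n → ℝ) {ε : ℝ} (hε : 0 ≤ ε) (τ : ℝ → ℝ → ℝ)
    (ρ : ℝ → ℝ) (s : ℝ) {φ : ℝ → ℂ} (hφ : ContDiff ℝ 3 φ) {A D : ℝ}
    (hA2 : ∀ t, ‖iteratedDeriv 2 φ t‖ ≤ A) (hA3 : ∀ t, ‖iteratedDeriv 3 φ t‖ ≤ A)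
    {ξ : Matrix (Fin n) (Fin n) ℂ} (hξ : ξ.IsHermitian) (i : Fin n) (v : Fin n → ℝ)
    (hD : ‖(1 / (n : ℂ)) * ∑ j, (v j : ℂ) * taylorQuotient φ (lam i) (lam j)
      - Xi τ ρ s φ‖ ≤ D) :
    ‖remainder lam ε τ ρ s φ i ξ‖ ^ 2 ≤
      4 * (A ^ 2 * (ε / √(n : ℝ)) ^ 6 *
            (n * ∑ j, ∑ k, ∑ l, (‖ξ i j‖ ^ 6 + ‖ξ j k‖ ^ 6 + ‖ξ i l‖ ^ 6))
        + (ε / √(n : ℝ)) ^ 4 *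
            ‖∑ j, ((‖ξ i j‖ ^ 2 - v j : ℝ) : ℂ) * taylorQuotient φ (lam i) (lam j)‖ ^ 2
        + (ε ^ 2 * D) ^ 2 + A ^ 2 * (ε / √(n : ℝ)) ^ 4 * ‖ξ i i‖ ^ 4) := by
  have hφ2 : ContDiff ℝ 2 φ := hφ.of_le (by norm_num)
  have hA0 : 0 ≤ A := (norm_nonneg _).trans (hA2 0)
  have hD0 : 0 ≤ D := (norm_nonneg _).trans hD
  have hn : 0 < (n : ℝ) := by exact_mod_cast i.pos
  set a := ε / √(n : ℝ) with ha
  have ha0 : 0 ≤ a := by positivity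
  have ha2 : a ^ 2 = ε ^ 2 * (1 / n) := by
    rw [ha, div_pow, Real.sq_sqrt hn.le]
    ring
  set g := taylorQuotient φ (lam i) with hg
  set B : Matrix (Fin n) (Fin n) ℂ := (ε : ℂ) • (((1 / √(n : ℝ) : ℝ) : ℂ) • ξ) with hB
  have hBa : ∀ j k, B j k = (a : ℂ) * ξ j k := by
    intro j k
    simp only [hB, Matrix.smul_apply, smul_eq_mul, ha]
    push_cast
    ring
  have hBn : ∀ j k, ‖B j k‖ = a * ‖ξ j k‖ := by
    intro j k
    rw [hBa, norm_mul, Complex.norm_real, Real.norm_of_nonneg ha0]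
  have hre : ((ξ i i).re : ℂ) = ξ i i := by
    have := hξ.apply i i
    exact Complex.conj_eq_iff_re.1 this
  have hBre : B i i = ((a * (ξ i i).re : ℝ) : ℂ) := by
    rw [hBa, Complex.ofReal_mul, hre]
  have hren : |(ξ i i).re| = ‖ξ i i‖ := by
    conv_rhs => rw [← hre, Complex.norm_real, Real.norm_eq_abs]
  have hHerm := perturbed_isHermitian lam ε hξ
  have h1 := norm_matrixFun_sub_le lam B hHerm i φ g (deriv φ (lam i)) (K := A)
    (fun t => taylor_eq hφ2 (lam i) t)
    (fun s t => by simpa using norm_taylorQuotient_sub_le hφ hA3 (lam i) s (lam i) t)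
  set F₁ := matrixFun φ (Matrix.diagonal (fun i => (lam i : ℂ)) + B) i i - φ (lam i) -
    B i i * deriv φ (lam i) - ∑ j, ((‖B i j‖ ^ 2 : ℝ) : ℂ) * g (lam j) with hF₁
  -- The last summand is minus the quadratic Taylor term of `φ` at `lam i + a * (ξ i i).re`; the
  -- constant and linear terms cancel against those of `φ(A)_{ii}`.
  have hdec : remainder lam ε τ ρ s φ i ξ = F₁ +
      ((a ^ 2 : ℝ) : ℂ) * ∑ j, ((‖ξ i j‖ ^ 2 - v j : ℝ) : ℂ) * g (lam j) +
      ((ε ^ 2 : ℝ) : ℂ) * ((1 / (n : ℂ)) * ∑ j, (v j : ℂ) * g (lam j) - Xi τ ρ s φ) +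
      -(((a * (ξ i i).re) ^ 2 : ℝ) : ℂ) * g (lam i + a * (ξ i i).re) := by
    have h2 := taylor_eq hφ2 (lam i) (lam i + a * (ξ i i).re)
    rw [add_sub_cancel_left, ← hg] at h2
    have h3 : ∑ j, ((‖B i j‖ ^ 2 : ℝ) : ℂ) * g (lam j) =
        ((a ^ 2 : ℝ) : ℂ) * ∑ j, ((‖ξ i j‖ ^ 2 - v j : ℝ) : ℂ) * g (lam j) +
        ((a ^ 2 : ℝ) : ℂ) * ∑ j, (v j : ℂ) * g (lam j) := by
      rw [← mul_add, ← Finset.sum_add_distrib, Finset.mul_sum]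
      refine Finset.sum_congr rfl fun j _ => ?_
      rw [hBn]
      push_cast
      ring
    have h4 : ((a ^ 2 : ℝ) : ℂ) = ((ε ^ 2 : ℝ) : ℂ) * (1 / (n : ℂ)) := by
      rw [ha2]
      push_cast
      ring
    rw [remainder, show perturbed lam ε ξ = Matrix.diagonal (fun i => (lam i : ℂ)) + B from rfl,
      hF₁, h3, ← ha, h2, hBre]
    rw [mul_sub, ← mul_assoc, ← h4]
    push_cast
    ring
  have hb1 : ‖F₁‖ ^ 2 ≤ A ^ 2 * a ^ 6 *
      (n * ∑ j, ∑ k, ∑ l, (‖ξ i j‖ ^ 6 + ‖ξ j k‖ ^ 6 + ‖ξ i l‖ ^ 6)) := by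
    calc ‖F₁‖ ^ 2 ≤ (A * ∑ j, ‖B i j‖ * (√(∑ k, ‖B j k‖ ^ 2) * √(∑ k, ‖B i k‖ ^ 2))) ^ 2 :=
          pow_le_pow_left₀ (norm_nonneg _) h1 2
      _ ≤ A ^ 2 * (n * ∑ j, ∑ k, ∑ l, (‖B i j‖ ^ 6 + ‖B j k‖ ^ 6 + ‖B i l‖ ^ 6)) := by
          rw [mul_pow]
          exact mul_le_mul_of_nonneg_left
            (sq_sum_mul_sqrt_mul_sqrt_le (fun j k => ‖B j k‖) i) (sq_nonneg _)
      _ = _ := by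
          simp only [hBn, mul_pow, ← mul_add, ← Finset.mul_sum]
          ring
  have hb2 : ‖((a ^ 2 : ℝ) : ℂ) * ∑ j, ((‖ξ i j‖ ^ 2 - v j : ℝ) : ℂ) * g (lam j)‖ ^ 2 =
      a ^ 4 * ‖∑ j, ((‖ξ i j‖ ^ 2 - v j : ℝ) : ℂ) * g (lam j)‖ ^ 2 := by
    rw [norm_mul, Complex.norm_real, Real.norm_of_nonneg (sq_nonneg _)]
    ring
  have hb3 : ‖((ε ^ 2 : ℝ) : ℂ) *
      ((1 / (n : ℂ)) * ∑ j, (v j : ℂ) * g (lam j) - Xi τ ρ s φ)‖ ^ 2 ≤ (ε ^ 2 * D) ^ 2 := by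
    rw [norm_mul, Complex.norm_real, Real.norm_of_nonneg (sq_nonneg _)]
    gcongr
  have hb4 : ‖-(((a * (ξ i i).re) ^ 2 : ℝ) : ℂ) * g (lam i + a * (ξ i i).re)‖ ^ 2 ≤
      A ^ 2 * a ^ 4 * ‖ξ i i‖ ^ 4 := by
    rw [norm_mul, norm_neg, Complex.norm_real, Real.norm_of_nonneg (sq_nonneg _), ← hren]
    have h5 := pow_le_pow_left₀ (norm_nonneg _)
      (norm_taylorQuotient_le hA2 (lam i) (lam i + a * (ξ i i).re)) 2
    have h6 : |(ξ i i).re| ^ 4 = (ξ i i).re ^ 4 := (even_two_mul 2).pow_abs _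
    rw [h6]
    have h7 := mul_le_mul_of_nonneg_left h5 (by positivity : 0 ≤ a ^ 4 * (ξ i i).re ^ 4)
    rw [mul_pow]
    linarith
  rw [hdec]
  refine (norm_sq_add_four_le _ _ _ _).trans ?_
  rw [hb2]
  gcongr

/-- The `L²` bound for the remainder, for fixed `n`. -/
lemma eLpNorm_remainder_le {Ω : Type*} [MeasurableSpace Ω] {P : Measure Ω}
    [IsProbabilityMeasure P] {n : ℕ} {ξ : Ω → Matrix (Fin n) (Fin n) ℂ}
    (hm : ∀ i j, Measurable fun ω => ξ ω i j) (hH : ∀ ω, (ξ ω).IsHermitian)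
    (hind : iIndepFun
      (fun (p : {p : Fin n × Fin n // p.1 ≤ p.2}) (ω : Ω) => ξ ω p.1.1 p.1.2) P)
    {M : NNReal} (hM : ∀ i j, ∫⁻ ω, ‖ξ ω i j‖ₑ ^ 6 ∂P ≤ M)
    (lam : Fin n → ℝ) {ε : ℝ} (hε : 0 ≤ ε) (τ : ℝ → ℝ → ℝ)
    (ρ : ℝ → ℝ) (s : ℝ) {φ : ℝ → ℂ} (hφ : ContDiff ℝ 3 φ) {A D : ℝ}
    (hA2 : ∀ t, ‖iteratedDeriv 2 φ t‖ ≤ A) (hA3 : ∀ t, ‖iteratedDeriv 3 φ t‖ ≤ A) (i : Fin n)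
    (hD : ‖(1 / (n : ℂ)) * ∑ j, (entryVariance P ξ i j : ℂ) * taylorQuotient φ (lam i) (lam j)
      - Xi τ ρ s φ‖ ≤ D) :
    eLpNorm (fun ω => remainder lam ε τ ρ s φ i (ξ ω)) 2 P ≤
      ENNReal.ofReal (2 * ε ^ 2 * (A * √(3 * M) * (ε * √(n : ℝ)) +
        2 * (A * √(1 + M) * (1 / √(n : ℝ))) + D)) := by
  have hA0 : 0 ≤ A := (norm_nonneg _).trans (hA2 0)
  have hD0 : 0 ≤ D := (norm_nonneg _).trans hD
  have hn : 1 ≤ (n : ℝ) := by exact_mod_cast i.pos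
  set r := √(n : ℝ) with hr
  have hr1 : 1 ≤ r := Real.one_le_sqrt.2 hn
  have hr2 : (n : ℝ) = r ^ 2 := (Real.sq_sqrt (by linarith)).symm
  set a := ε / r with ha
  have har : a * r = ε := div_mul_cancel₀ _ (by linarith)
  have ha0 : 0 ≤ a := by positivity
  set g := taylorQuotient φ (lam i) with hg
  obtain ⟨i1, b1⟩ := integral_sum_pow_six_le hm hM i
  obtain ⟨i2, b2⟩ := integral_norm_sq_sum_le hm hH hind hM (fun j => g (lam j)) i
  obtain ⟨i4, b4⟩ := integrable_pow_of_le_six (hm i i) (hM i i) (k := 4) (by norm_num)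
  have j1 := (i1.const_mul (n : ℝ)).const_mul (A ^ 2 * a ^ 6)
  have j2 := i2.const_mul (a ^ 4)
  have j3 : Integrable (fun _ : Ω => (ε ^ 2 * D) ^ 2) P := integrable_const _
  have j4 := i4.const_mul (A ^ 2 * a ^ 4)
  have j12 := j1.add j2
  have j123 := j12.add j3
  refine eLpNorm_two_le_of_sq_le
    (fun ω => norm_sq_remainder_le lam hε τ ρ s hφ hA2 hA3 (hH ω) i _ hD)
    ((j123.add j4).const_mul 4) (by positivity) ?_
  have hsum := (integral_add' j123 j4).trans (congrArg (· + _) ((integral_add' j12 j3).trans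
    (congrArg (· + _) (integral_add' j1 j2))))
  rw [integral_const_mul]
  refine (le_of_eq (congrArg (4 * ·) hsum)).trans ?_
  simp only [integral_const_mul, integral_const, probReal_univ, one_smul]
  have hz : ∑ j, ‖g (lam j)‖ ^ 2 ≤ r ^ 2 * A ^ 2 := by
    calc ∑ j, ‖g (lam j)‖ ^ 2 ≤ ∑ _j : Fin n, A ^ 2 :=
          Finset.sum_le_sum fun j _ =>
            pow_le_pow_left₀ (norm_nonneg _) (norm_taylorQuotient_le hA2 _ _) 2
      _ = _ := by simp [hr2]
  have hM0 : (0 : ℝ) ≤ M := M.2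
  set m3 := √(3 * (M : ℝ)) with hm3
  set m1 := √(1 + (M : ℝ)) with hm1
  have em3 : 3 * (M : ℝ) = m3 ^ 2 := (Real.sq_sqrt (by positivity)).symm
  have em1 : 1 + (M : ℝ) = m1 ^ 2 := (Real.sq_sqrt (by positivity)).symm
  rw [em3, hr2] at b1
  rw [em1] at b2 b4
  -- Power count: `a⁶ · n · n³ = ε⁶ n`, the square of `ε² · ε√n`.
  have t1 : A ^ 2 * a ^ 6 * ((n : ℝ) * ∫ ω, ∑ j, ∑ k, ∑ l,
      (‖ξ ω i j‖ ^ 6 + ‖ξ ω j k‖ ^ 6 + ‖ξ ω i l‖ ^ 6) ∂P) ≤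
      (ε ^ 2 * (A * m3 * (ε * r))) ^ 2 := by
    rw [hr2]
    calc _ ≤ A ^ 2 * a ^ 6 * (r ^ 2 * ((r ^ 2) ^ 3 * m3 ^ 2)) := by gcongr
      _ = _ := by
        rw [← har]
        ring
  have e2 : ε ^ 2 * (1 / r) = a ^ 2 * r := by
    rw [← har]
    field_simp
  have t2 : a ^ 4 * ∫ ω, ‖∑ j, ((‖ξ ω i j‖ ^ 2 - entryVariance P ξ i j : ℝ) : ℂ) *
      g (lam j)‖ ^ 2 ∂P ≤ (ε ^ 2 * (A * m1 * (1 / r))) ^ 2 := by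
    calc _ ≤ a ^ 4 * ((r ^ 2 * A ^ 2) * m1 ^ 2) := by
          gcongr
          exact b2.trans (by gcongr)
      _ = (A * m1 * (a ^ 2 * r)) ^ 2 := by ring
      _ = _ := by
        rw [← e2]
        ring
  have t4 : A ^ 2 * a ^ 4 * ∫ ω, ‖ξ ω i i‖ ^ 4 ∂P ≤ (ε ^ 2 * (A * m1 * (1 / r))) ^ 2 := by
    calc _ ≤ A ^ 2 * a ^ 4 * m1 ^ 2 := by
          gcongr
      _ = (A * m1 * (a ^ 2 * 1)) ^ 2 := by ring
      -- A factor `r ≥ 1` is given away so that the diagonal term shares the bound of the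
      -- fluctuation; hence the coefficient `2` on that bound.
      _ ≤ (A * m1 * (a ^ 2 * r)) ^ 2 := by gcongr
      _ = _ := by
        rw [← e2]
        ring
  have p1 : 0 ≤ ε ^ 2 * (A * m3 * (ε * r)) := by positivity
  have p2 : 0 ≤ ε ^ 2 * (A * m1 * (1 / r)) := by positivity
  have p3 : 0 ≤ ε ^ 2 * D := by positivity
  have hfin : ∀ x y z : ℝ, 0 ≤ x → 0 ≤ y → 0 ≤ z →
      4 * (x ^ 2 + y ^ 2 + z ^ 2 + y ^ 2) ≤ (2 * (x + 2 * y + z)) ^ 2 := by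
    intro x y z hx hy hz
    nlinarith [mul_nonneg hx hy, mul_nonneg hx hz, mul_nonneg hy hz, sq_nonneg y]
  refine le_trans ?_ ((hfin _ _ _ p1 p2 p3).trans (le_of_eq ?_))
  · linarith
  · ring

end PerturbedDiagonal

end

/-! ### The main theorem -/

theorem theorem2p1 {Ω : ℕ → Type*} [∀ n, MeasurableSpace (Ω n)]
    (P : ∀ n, Measure (Ω n)) [∀ n, IsProbabilityMeasure (P n)]
    (lam : ∀ n, Fin n → ℝ) (ξ : ∀ n, Ω n → Matrix (Fin n) (Fin n) ℂ)
    (f ρ : ℝ → ℝ) (σ τ : ℝ → ℝ → ℝ) (ε : ℕ → ℝ)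
    (ha : PerturbedDiagonal.EntryHypotheses P ξ)
    (hb : PerturbedDiagonal.ProfileHypotheses P lam ξ f σ)
    (hc : PerturbedDiagonal.DensityHypotheses f ρ)
    (hd : PerturbedDiagonal.VarianceHypotheses f σ τ)
    (hε_pos : ∀ n, 0 < ε n)
    (hε : Tendsto (fun n : ℕ => ε n * √(n : ℝ)) atTop (𝓝 0)) :
    -- the constant depends on `φ` only through an interval containing its support
    ∀ R : ℝ, ∃ C : ℝ, 0 < C ∧
      ∀ φ : ℝ → ℂ, ContDiff ℝ 7 φ → tsupport φ ⊆ Icc (-R) R →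
        ∀ x ∈ Icc (0 : ℝ) 1,
          Integrable (PerturbedDiagonal.xiIntegrand τ ρ (f x) φ) ∧
          ∀ (n : ℕ) (i : Fin n), PerturbedDiagonal.IsFloorIndex n x i →
            let U : Ω n → ℂ := fun ω =>
              PerturbedDiagonal.remainder (lam n) (ε n) τ ρ (f x) φ i (ξ n ω)
            MemLp U 2 (P n) ∧
            eLpNorm U 2 (P n) ≤ ENNReal.ofReal
              (C * (ε n ^ 2 * ((⨆ t : ℝ, ‖iteratedDeriv 7 φ t‖) *
                (PerturbedDiagonal.eta (P n) (lam n) (ξ n) f σ + 1 / √(n : ℝ)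
                  + ε n * √(n : ℝ))))) := by
  open PerturbedDiagonal in
  intro R
  obtain ⟨M, hM⟩ := ha.sixth_moment
  obtain ⟨Mσ, hMσ⟩ := hb.σ_bounded
  have hM0 : (0 : ℝ) ≤ M := M.2
  -- `V` dominates both the entry variances (at most `1 + M`) and `σ²` (at most `Mσ ^ 2`).
  set V : ℝ := 1 + M + Mσ ^ 2 with hV
  have hV0 : 0 ≤ V := by positivity
  have hσV : ∀ x ∈ Icc (0 : ℝ) 1, ∀ y ∈ Icc (0 : ℝ) 1, σ x y ^ 2 ≤ V := by
    intro x hx y hy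
    have := pow_le_pow_left₀ (abs_nonneg _) (hMσ x hx y hy) 2
    rw [sq_abs] at this
    linarith
  set L : ℝ := 2 * |R| + 1 with hL
  have hL1 : 1 ≤ L := by linarith [abs_nonneg R]
  set C₀ : ℝ := √(3 * M) + 2 * √(1 + M) + (1 + 4 * V) with hC₀
  have hC₀0 : 0 < C₀ := by positivity
  -- The `2` comes from `eLpNorm_remainder_le`, and `L ^ 5` from the five steps down from `φ⁽⁷⁾` to
  -- `φ''`. `C₀` dominates the coefficients of `η`, `1/√n` and `ε√n`.
  refine ⟨2 * (L ^ 5 * C₀), by positivity, fun φ hφ hsupp x hx => ?_⟩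
  set N : ℝ := ⨆ t : ℝ, ‖iteratedDeriv 7 φ t‖ with hN
  have hN0 : 0 ≤ N := Real.iSup_nonneg fun t => norm_nonneg _
  set A : ℝ := L ^ 5 * N with hA
  have hA2 : ∀ t, ‖iteratedDeriv 2 φ t‖ ≤ A :=
    norm_iteratedDeriv_le_iSup hφ hsupp 5 (by norm_num)
  have hA3 : ∀ t, ‖iteratedDeriv 3 φ t‖ ≤ A := fun t =>
    (norm_iteratedDeriv_le_iSup hφ hsupp 4 (by norm_num) t).trans
      (mul_le_mul_of_nonneg_right (pow_le_pow_right₀ hL1 (by norm_num)) hN0)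
  have hA0 : 0 ≤ A := by positivity
  refine ⟨(integrable_xiIntegrand_and_Xi_eq hc hd (hφ.of_le (by norm_num)) hA2 hx
    (hσV x hx)).1, fun n i hi => ?_⟩
  intro U
  have hφ3 : ContDiff ℝ 3 φ := hφ.of_le (by norm_num)
  have hvar : ∀ j, 0 ≤ entryVariance (P n) (ξ n) i j ∧ entryVariance (P n) (ξ n) i j ≤ V := by
    intro j
    have := (integrable_pow_of_le_six (ha.measurable n i j) (hM n i j) (k := 2) (by norm_num)).2
    exact ⟨integral_nonneg fun ω => by positivity, this.trans (by linarith [sq_nonneg Mσ])⟩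
  have hdet := norm_variance_sum_sub_Xi_le (P n) (lam := lam n) (ξ := ξ n) hb.f_bounded
    hb.σ_bounded hc hd hφ3 hA2 hA3 hx (hσV x hx) hi hvar
  have hbound := eLpNorm_remainder_le (ha.measurable n) (ha.hermitian n) (ha.indep n) (hM n)
    (lam n) (hε_pos n).le τ ρ (f x) hφ3 hA2 hA3 i hdet
  obtain ⟨a, b, ha', hb', hη, -, -⟩ := exists_eta_eq_add (P n) (lam n) (ξ n) hb.f_bounded
    hb.σ_bounded
  have hη0 : 0 ≤ eta (P n) (lam n) (ξ n) f σ := by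
    rw [hη]
    positivity
  have hmeas : Measurable U :=
    measurable_remainder (lam n) (ε n) τ ρ (f x) hφ.continuous i (ha.measurable n)
      (ha.hermitian n)
  refine ⟨⟨hmeas.aestronglyMeasurable, hbound.trans_lt ENNReal.ofReal_lt_top⟩,
    hbound.trans (ENNReal.ofReal_le_ofReal ?_)⟩
  set η := eta (P n) (lam n) (ξ n) f σ with hηdef
  have hn : 1 ≤ (n : ℝ) := by exact_mod_cast i.pos
  have hinv : 1 / (n : ℝ) ≤ 1 / √(n : ℝ) :=
    one_div_le_one_div_of_le (by positivity) (Real.sqrt_le_iff.2 ⟨by linarith, by nlinarith⟩)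
  set u := ε n * √(n : ℝ) with hu
  set w := 1 / √(n : ℝ) with hw
  have hu0 : 0 ≤ u := mul_nonneg (hε_pos n).le (Real.sqrt_nonneg _)
  have hw0 : 0 ≤ w := by positivity
  have hkey : A * √(3 * M) * u + 2 * (A * √(1 + M) * w) +
      A * ((1 + 2 * V) * η + 2 * V * (1 / n)) ≤ A * (C₀ * (η + w + u)) := by
    have h1 : √(3 * (M : ℝ)) * u + 2 * (√(1 + (M : ℝ)) * w) +
        ((1 + 2 * V) * η + 2 * V * (1 / n)) ≤ C₀ * (η + w + u) := by
      have h2 : 2 * V * (1 / (n : ℝ)) ≤ 2 * V * w := by gcongr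
      have h3 : 0 ≤ √(3 * (M : ℝ)) * (η + w) := by positivity
      have h4 : 0 ≤ √(1 + (M : ℝ)) * (η + u) := by positivity
      have h5 : 0 ≤ V * (η + w + u) := by positivity
      have h6 : 0 ≤ V * η := by positivity
      have h7 : 0 ≤ V * w := by positivity
      have h8 : 0 ≤ V * u := by positivity
      rw [hC₀]
      linarith
    have := mul_le_mul_of_nonneg_left h1 hA0
    linarith
  calc _ ≤ 2 * ε n ^ 2 * (A * (C₀ * (η + w + u))) := by gcongr
    _ = _ := by
      rw [hA]
      ring
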